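/- Let $0<p<1$. An elephant random walk with parameter $p$ and memory sets $M_k\subseteq\{1,\dots,k\}$, $k\ge 1$, is a sequence of random variables $X_1,X_2,\dots$ such that $P(X_1=1)=p$, $P(X_1=-1)=1-p$ and, for every $k\ge1$ with $M_k\neq\emptyset$, almost surely $X_{k+1}=\varepsilon X_K$, where $K$ is uniformly distributed on $M_k$, $P(\varepsilon=1)=p=1-P(\varepsilon=-1)$, and $K$, $\varepsilon$ and $(X_1,\dots,X_k)$ are independent. The walk has full memory if $M_k=\{1,\dots,k\}$ for all $k$; its memory is the first $m$ steps if $M_k=\{1,\dots,\min(k,m)\}$ for all $k$ (so that it behaves as the walk with full memory up to time $m$). Let $m=m_n$ be non-negative integers with $m_n\to\infty$ and $m_n/n\to0$ as $n\to\infty$. For each $n$ let $X_{n,1},X_{n,2},\dots$ be an elephant random walk with parameter $p$ whose memory is the first $m_n$ steps (walks with different $n$ may live on different probability spaces), and put $S_n=\sum_{k=1}^nX_{n,k}$. Then, as $n\to\infty$: (a) If $0<p<3/4$, then $$\frac{S_n\sqrt{m}}{n}\ \xrightarrow{d}\ \mathcal N\Big(0,\frac{(2p-1)^2}{3-4p}\Big),$$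 where $\mathcal N(0,0)$ is the unit mass at $0$. (b) If $p=3/4$, then $$\frac{S_n\sqrt{m/\log m}}{n}\ \xrightarrow{d}\ \mathcal N\Big(0,\frac14\Big).$$ (c) If $3/4<p<1$, and $Y_1,Y_2,\dots$ is an elephant random walk with parameter $p$ and full memory, then there is a random variable $L$ on the probability space of $(Y_k)$ such that $k^{-(2p-1)}\sum_{i=1}^kY_i\to L$ almost surely as $k\to\infty$, and $$\frac{S_n\,m^{2(1-p)}}{n}\ \xrightarrow{d}\ (2p-1)\,L .$$ -/

import Mathlib

open MeasureTheory ProbabilityTheory Filter Topology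

/-- `X 1, X 2, …` are the steps of an elephant random walk with parameter `p` and memory sets
`M k ⊆ {1, …, k}` (what the elephant remembers after `k` steps): the first step is `1` with
probability `p` and `-1` with probability `1 - p`; the step after time `k` is `ε * X K`, where `K`
is uniform on `M k`, the sign `ε` is `1` with probability `p` and `-1` with probability `1 - p`, and
`K`, `ε` and the past `(X 1, …, X k)` are independent. (The rule is void when `M k` is empty.) -/
structure IsElephantWalk {Ω : Type*} [MeasurableSpace Ω] (μ : Measure Ω) (p : ℝ)
    (M : ℕ → Finset ℕ) (X : ℕ → Ω → ℝ) : Prop where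
  measurable : ∀ k, Measurable (X k)
  first_pos : μ.real {ω | X 1 ω = 1} = p
  first_neg : μ.real {ω | X 1 ω = -1} = 1 - p
  step : ∀ k, 1 ≤ k → (M k).Nonempty →
    ∃ (K : Ω → ℕ) (ε : Ω → ℝ), Measurable K ∧ Measurable ε ∧
      (∀ i ∈ M k, μ.real {ω | K ω = i} = 1 / ((M k).card : ℝ)) ∧
      μ.real {ω | ε ω = 1} = p ∧ μ.real {ω | ε ω = -1} = 1 - p ∧
      IndepFun K ε μ ∧
      IndepFun (fun ω => (K ω, ε ω)) (fun ω (i : Finset.Icc 1 k) => X i ω) μ ∧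
      ∀ᵐ ω ∂μ, X (k + 1) ω = ε ω * X (K ω) ω

/-- The memory of an elephant that remembers everything: `{1, …, k}` after `k` steps. -/
def fullMemory (k : ℕ) : Finset ℕ := Finset.Icc 1 k

/-- The memory of an elephant that remembers only the first `m` steps: after `k` steps this is
`{1, …, min k m}`, so that the walk has full memory up to time `m`. -/
def firstSteps (m k : ℕ) : Finset ℕ := Finset.Icc 1 (min k m)

/-- The position `S_n = X_1 + ⋯ + X_n`. -/
def position {Ω : Type*} (X : ℕ → Ω → ℝ) (n : ℕ) (ω : Ω) : ℝ := ∑ k ∈ Finset.Icc 1 n, X k ω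

/-!
Write `a = 2p - 1`. Given the past, the step after time `k` has the mean `a` times the mean of the
remembered steps (`IsElephantWalk.integral_smul_past`, `IsElephantWalk.integral_smul_position`).
This has two consequences.

After time `m` the walk that remembers `{1, …, m}` makes steps whose conditional mean, given the
first `m` steps, is `a S_m / m`, and whose deviations from it are orthogonal. So
`S_n = S_m + (n - m) a S_m / m + O(√n)` in `L²`, and as `m / n → 0` the limits follow from those of
`a S_m / s(m)`, where `s(m)` is `√m`, `√(m log m)` or `m ^ a`: see
`IsElephantWalk.integral_fluctuation_sq_le` and `tendstoInDistribution_position`. Up to time `m`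
the walk has full memory.

For full memory, `S_k / b_k` is a martingale, where `b_k = ∏_{0 < j < k} (1 + a / j)`, and
`b_k ~ k ^ a / Γ(1 + a)` by Euler's limit formula (`tendsto_growth_div_rpow`). The second moment of
`S_k / b_k` is at most `∑_{j ≤ k} b_j⁻²`, which stays bounded exactly if `p > 3/4`.

* For `p ≤ 3/4`, let `φ_k(c)` be the characteristic function of `S_k / b_k` at `c`. One step
  changes `φ_k(c)` into `exp (-c² b_{k+1}⁻² / 2) φ_k(c)`, up to an error of order
  `|c / b_{k+1}|³ + (c / b_{k+1})² E (S_k / k)²` (`norm_cos_add_sin_sub_cexp_le`). The errors add up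
  (`IsElephantWalk.norm_integral_cexp_position_sub_le`) and are negligible in total
  (`tendsto_cltError_sum`). So `S_k / b_k` is asymptotically Gaussian with variance
  `∑_{j ≤ k} b_j⁻²`, and what remains are the asymptotics of this sum
  (`tendsto_varBound_div_of_lt`, `tendsto_varBound_div_log`) and Lévy's continuity theorem.
* For `p > 3/4` the martingale is bounded in `L²`, hence converges almost surely
  (`IsElephantWalk.exists_ae_tendsto_position_div_rpow`). As the law of `S_m` is the same for all
  walks that have full memory up to time `m` (`map_position_eq`), the limit carries over to the
  walks in question.
-/

/-! ### Steps of an elephant random walk -/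

section Steps

variable {Ω : Type*} [MeasurableSpace Ω] {μ : Measure Ω} [IsProbabilityMeasure μ]

lemma ae_eq_one_or_neg_one {p : ℝ} {f : Ω → ℝ} (hf : Measurable f)
    (h1 : μ.real {ω | f ω = 1} = p) (h2 : μ.real {ω | f ω = -1} = 1 - p) :
    ∀ᵐ ω ∂μ, f ω = 1 ∨ f ω = -1 := by
  have m1 : MeasurableSet {ω | f ω = 1} := hf (measurableSet_singleton 1)
  have m2 : MeasurableSet {ω | f ω = -1} := hf (measurableSet_singleton (-1))
  have hd : Disjoint {ω | f ω = 1} {ω | f ω = -1} := by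
    rw [Set.disjoint_left]
    intro ω h h'
    simp only [Set.mem_ofPred_eq] at h h'
    linarith
  have hu : μ.real ({ω | f ω = 1} ∪ {ω | f ω = -1}) = 1 := by
    rw [measureReal_union hd m2, h1, h2]; ring
  have : μ.real ({ω | f ω = 1} ∪ {ω | f ω = -1})ᶜ = 0 := by
    rw [probReal_compl_eq_one_sub (m1.union m2), hu, sub_self]
  rw [measureReal_eq_zero_iff] at this
  rw [ae_iff]
  exact this

lemma integral_of_two_point {p : ℝ} {f : Ω → ℝ} (hf : Measurable f)
    (h1 : μ.real {ω | f ω = 1} = p) (h2 : μ.real {ω | f ω = -1} = 1 - p) :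
    ∫ ω, f ω ∂μ = 2 * p - 1 := by
  have m1 : MeasurableSet {ω | f ω = 1} := hf (measurableSet_singleton 1)
  have m2 : MeasurableSet {ω | f ω = -1} := hf (measurableSet_singleton (-1))
  have : f =ᵐ[μ] fun ω ↦ {ω | f ω = 1}.indicator (fun _ ↦ (1 : ℝ)) ω
      - {ω | f ω = -1}.indicator (fun _ ↦ (1 : ℝ)) ω := by
    filter_upwards [ae_eq_one_or_neg_one hf h1 h2] with ω hω
    rcases hω with hω | hω <;> simp [Set.indicator, hω] <;> norm_num
  rw [integral_congr_ae this, integral_sub, integral_indicator_const _ m1,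
    integral_indicator_const _ m2, h1, h2]
  · simp only [smul_eq_mul]; ring
  · exact (integrable_const _).indicator m1
  · exact (integrable_const _).indicator m2

/-- A variable that is uniform on a finite set almost surely takes its values there. -/
lemma ae_mem_of_uniform {K : Ω → ℕ} (hK : Measurable K) {s : Finset ℕ} (hs : s.Nonempty)
    (h : ∀ i ∈ s, μ.real {ω | K ω = i} = 1 / (s.card : ℝ)) : ∀ᵐ ω ∂μ, K ω ∈ s := by
  have hc : (s.card : ℝ) ≠ 0 := by exact_mod_cast hs.card_pos.ne'
  have hsum : μ.real (K ⁻¹' s) = 1 := by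
    rw [← sum_measureReal_preimage_singleton s (fun i _ ↦ hK (measurableSet_singleton i)),
      (Finset.sum_congr rfl h :
        ∑ i ∈ s, μ.real (K ⁻¹' {i}) = ∑ i ∈ s, 1 / (s.card : ℝ))]
    simp [hc]
  have : μ.real (K ⁻¹' s)ᶜ = 0 := by
    rw [probReal_compl_eq_one_sub (hK s.measurableSet), hsum, sub_self]
  rw [measureReal_eq_zero_iff] at this
  rw [ae_iff]
  exact this

/-- From time `1` on, the memory is never empty and never reaches beyond the past. -/
def IsMemory (M : ℕ → Finset ℕ) : Prop :=
  ∀ k, 1 ≤ k → (M k).Nonempty ∧ M k ⊆ Finset.Icc 1 k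

lemma isMemory_fullMemory : IsMemory fullMemory := fun _ hk ↦
  ⟨Finset.nonempty_Icc.2 hk, subset_rfl⟩

lemma isMemory_firstSteps {m : ℕ} (hm : 1 ≤ m) : IsMemory (firstSteps m) := fun k hk ↦
  ⟨Finset.nonempty_Icc.2 (by omega), Finset.Icc_subset_Icc le_rfl (by omega)⟩

/-- `(X 1, …, X k)` as a random vector. -/
def past (X : ℕ → Ω → ℝ) (k : ℕ) (ω : Ω) (i : Finset.Icc 1 k) : ℝ := X i ω

namespace IsElephantWalk

variable {p : ℝ} {M : ℕ → Finset ℕ} {X : ℕ → Ω → ℝ}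

omit [IsProbabilityMeasure μ] in
lemma measurable_past (h : IsElephantWalk μ p M X) (k : ℕ) : Measurable (past X k) :=
  measurable_pi_lambda _ fun i ↦ h.measurable i

lemma ae_sign (h : IsElephantWalk μ p M X) (hM : IsMemory M) {k : ℕ} (hk : 1 ≤ k) :
    ∀ᵐ ω ∂μ, X k ω = 1 ∨ X k ω = -1 := by
  induction k using Nat.strong_induction_on with
  | _ k ih =>
    obtain rfl | hk1 := hk.eq_or_lt
    · exact ae_eq_one_or_neg_one (h.measurable 1) h.first_pos h.first_neg
    obtain ⟨j, rfl⟩ : ∃ j, k = j + 1 := ⟨k - 1, by omega⟩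
    have hj : 1 ≤ j := by omega
    obtain ⟨K, ε, hK, hε, hKu, he1, he2, -, -, hX⟩ := h.step j hj (hM j hj).1
    have hall : ∀ᵐ ω ∂μ, ∀ i : ℕ, i ∈ M j → X i ω = 1 ∨ X i ω = -1 := by
      rw [ae_all_iff]
      intro i
      by_cases hi : i ∈ M j
      · have := Finset.mem_Icc.1 ((hM j hj).2 hi)
        filter_upwards [ih i (by omega) this.1] with ω hω _ using hω
      · simp [hi]
    filter_upwards [ae_eq_one_or_neg_one hε he1 he2, ae_mem_of_uniform hK (hM j hj).1 hKu, hX, hall]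
      with ω h1 h2 h3 h4
    rw [h3]
    rcases h1 with h1 | h1 <;> rcases h4 _ h2 with h5 | h5 <;> simp [h1, h5]

lemma ae_abs_le (h : IsElephantWalk μ p M X) (hM : IsMemory M) {k : ℕ} (hk : 1 ≤ k) :
    ∀ᵐ ω ∂μ, |X k ω| ≤ 1 := by
  filter_upwards [h.ae_sign hM hk] with ω hω
  rcases hω with hω | hω <;> simp [hω]

lemma integrable_smul (h : IsElephantWalk μ p M X) (hM : IsMemory M) {k : ℕ} (hk : 1 ≤ k)
    {E : Type*} [NormedAddCommGroup E] [NormedSpace ℝ E] {g : Ω → E} (hg : Integrable g μ) :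
    Integrable (fun ω ↦ X k ω • g ω) μ :=
  hg.bdd_smul 1 (h.measurable k).aestronglyMeasurable (h.ae_abs_le hM hk)

/-- Given the past, the mean of the next step is `2p - 1` times the mean of the remembered steps:
the identity that defines this conditional expectation, tested against functions of the past. -/
lemma integral_smul_past (h : IsElephantWalk μ p M X) (hM : IsMemory M) {k : ℕ} (hk : 1 ≤ k)
    {E : Type*} [NormedAddCommGroup E] [NormedSpace ℝ E]
    {g : (Finset.Icc 1 k → ℝ) → E} (hg : StronglyMeasurable g)
    (hgi : Integrable (fun ω ↦ g (past X k ω)) μ) :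
    ∫ ω, X (k + 1) ω • g (past X k ω) ∂μ =
      (2 * p - 1) • ∫ ω, ((∑ i ∈ M k, X i ω) / (M k).card) • g (past X k ω) ∂μ := by
  obtain ⟨K, ε, hK, hε, hKu, he1, he2, hind, hindp, hX⟩ := h.step k hk (hM k hk).1
  have hsub := (hM k hk).2
  have hmean := integral_of_two_point hε he1 he2
  have hle : ∀ᵐ ω ∂μ, |ε ω| ≤ 1 := by
    filter_upwards [ae_eq_one_or_neg_one hε he1 he2] with ω hω
    rcases hω with hω | hω <;> simp [hω]
  let c : ℕ → ℕ × ℝ → ℝ := fun i x ↦ ({i} : Set ℕ).indicator 1 x.1 * x.2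
  have hcm : ∀ i, Measurable (c i) := fun i ↦
    ((measurable_one.indicator (measurableSet_singleton i)).comp measurable_fst).mul measurable_snd
  have hcle : ∀ i, ∀ᵐ ω ∂μ, ‖c i (K ω, ε ω)‖ ≤ 1 := by
    intro i
    filter_upwards [hle] with ω hω
    simp only [c, Set.indicator, Real.norm_eq_abs]
    split_ifs <;> simp [hω]
  have hrw : (fun ω ↦ X (k + 1) ω • g (past X k ω)) =ᵐ[μ]
      fun ω ↦ ∑ i ∈ M k, c i (K ω, ε ω) • (X i ω • g (past X k ω)) := by
    filter_upwards [hX, ae_mem_of_uniform hK (hM k hk).1 hKu] with ω h1 h2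
    rw [Finset.sum_eq_single_of_mem _ h2, h1]
    · simp [c, smul_smul]
    · intro i _ hi
      simp [c, Set.indicator, hi.symm]
  have hXi : ∀ i ∈ M k, Integrable (fun ω ↦ X i ω • g (past X k ω)) μ := fun i hi ↦
    h.integrable_smul hM (Finset.mem_Icc.1 (hsub hi)).1 hgi
  have hterm : ∀ i ∈ M k, ∫ ω, c i (K ω, ε ω) • (X i ω • g (past X k ω)) ∂μ
      = ((2 * p - 1) / (M k).card) • ∫ ω, X i ω • g (past X k ω) ∂μ := by
    intro i hi
    have hfac := IndepFun.integral_fun_comp_smul_comp (𝕜 := ℝ) (f := c i)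
      (g := fun x : Finset.Icc 1 k → ℝ ↦ x ⟨i, hsub hi⟩ • g x) hindp
      (hK.prodMk hε).aemeasurable (h.measurable_past k).aemeasurable
      (hcm i).aestronglyMeasurable
      ((measurable_pi_apply _).stronglyMeasurable.smul hg).aestronglyMeasurable
    have hc : ∫ ω, c i (K ω, ε ω) ∂μ = (2 * p - 1) / (M k).card := by
      have := IndepFun.integral_fun_comp_mul_comp (𝕜 := ℝ)
        (f := ({i} : Set ℕ).indicator 1) (g := id) hind
        hK.aemeasurable hε.aemeasurable
        (measurable_one.indicator (measurableSet_singleton i)).aestronglyMeasurable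
        measurable_id.aestronglyMeasurable
      have hKi : ∫ ω, ({i} : Set ℕ).indicator (1 : ℕ → ℝ) (K ω) ∂μ = 1 / (M k).card := by
        rw [← hKu i hi]
        exact integral_indicator_one (hK (measurableSet_singleton i))
      simp only [c]
      refine this.trans ?_
      simp only [id, hKi, hmean]
      ring
    rw [← hc]
    exact hfac
  rw [integral_congr_ae hrw, integral_finsetSum, Finset.sum_congr rfl hterm, ← Finset.smul_sum,
    ← integral_finsetSum _ hXi]
  · simp_rw [div_eq_inv_mul, ← smul_smul, ← Finset.sum_smul]
    rw [integral_smul, smul_comm]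
  · exact fun i hi ↦ (hXi i hi).bdd_smul 1
      ((hcm i).comp (hK.prodMk hε)).aestronglyMeasurable (hcle i)

end IsElephantWalk

end Steps

/-! ### The normalising sequences -/

/-- `b_n = ∏_{0 < j < n} (1 + a / j)`: for `a = 2p - 1` the mean of `S_{k+1} / b_{k+1}` given the
first `k` steps is `S_k / b_k`. The factor with `j = 0` is `1`, as `a / 0 = 0`. -/
noncomputable def growth (a : ℝ) (n : ℕ) : ℝ := ∏ j ∈ Finset.range n, (1 + a / j)

/-- `∑_{k ≤ n} b_k⁻²`, which bounds the second moment of the martingale `S_n / b_n`. -/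
noncomputable def invSqSum (a : ℝ) (n : ℕ) : ℝ := ∑ k ∈ Finset.range n, (growth a (k + 1) ^ 2)⁻¹

/-- `b_n² ∑_{k ≤ n} b_k⁻²`, a bound for the second moment of `S_n`, and asymptotically equal to it
if `a ≤ 1/2`. -/
noncomputable def varBound (a : ℝ) (n : ℕ) : ℝ := growth a n ^ 2 * invSqSum a n

section Growth

variable {a : ℝ}

lemma growth_succ (a : ℝ) (n : ℕ) : growth a (n + 1) = growth a n * (1 + a / n) :=
  Finset.prod_range_succ _ _

lemma growth_one (a : ℝ) : growth a 1 = 1 := by simp [growth]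

lemma one_add_div_pos (ha : -1 < a) (n : ℕ) : 0 < 1 + a / n := by
  rcases Nat.eq_zero_or_pos n with rfl | hn
  · simp
  · have hn' : (1 : ℝ) ≤ n := by exact_mod_cast hn
    have : 0 < (n + a) / n := div_pos (by linarith) (by linarith)
    rwa [add_div, div_self (by linarith)] at this

lemma growth_pos (ha : -1 < a) (n : ℕ) : 0 < growth a n :=
  Finset.prod_pos fun j _ ↦ one_add_div_pos ha j

lemma invSqSum_succ (a : ℝ) (n : ℕ) :
    invSqSum a (n + 1) = invSqSum a n + (growth a (n + 1) ^ 2)⁻¹ := Finset.sum_range_succ _ _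

lemma invSqSum_nonneg (a : ℝ) (n : ℕ) : 0 ≤ invSqSum a n :=
  Finset.sum_nonneg fun _ _ ↦ by positivity

lemma invSqSum_mono (a : ℝ) : Monotone (invSqSum a) :=
  monotone_nat_of_le_succ fun n ↦ by
    rw [invSqSum_succ]; exact le_add_of_nonneg_right (by positivity)

lemma varBound_nonneg (a : ℝ) (n : ℕ) : 0 ≤ varBound a n :=
  mul_nonneg (sq_nonneg _) (invSqSum_nonneg _ _)

lemma varBound_succ (ha : -1 < a) (n : ℕ) :
    varBound a (n + 1) = (1 + a / n) ^ 2 * varBound a n + 1 := by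
  have h := (growth_pos ha (n + 1)).ne'
  have h2 : growth a (n + 1) ^ 2 * (growth a (n + 1) ^ 2)⁻¹ = 1 := mul_inv_cancel₀ (pow_ne_zero 2 h)
  rw [varBound, invSqSum_succ, mul_add, h2, growth_succ, varBound]
  ring

lemma varBound_one (ha : -1 < a) : varBound a 1 = 1 := by
  rw [varBound_succ ha 0]; simp [varBound, invSqSum]

end Growth

/-! ### Positions -/

section Position

variable {Ω : Type*} [MeasurableSpace Ω] {μ : Measure Ω}

omit [MeasurableSpace Ω] in
lemma position_succ (X : ℕ → Ω → ℝ) (k : ℕ) (ω : Ω) :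
    position X (k + 1) ω = position X k ω + X (k + 1) ω :=
  Finset.sum_Icc_succ_top (by omega) _

omit [MeasurableSpace Ω] in
lemma position_one (X : ℕ → Ω → ℝ) (ω : Ω) : position X 1 ω = X 1 ω := by simp [position]

omit [MeasurableSpace Ω] in
/-- The position at an earlier time is a function of the past. -/
lemma position_eq_past (X : ℕ → Ω → ℝ) {j k : ℕ} (hjk : j ≤ k) (ω : Ω) :
    position X j ω = ∑ i : Finset.Icc 1 k, if (i : ℕ) ≤ j then past X k ω i else 0 := by
  simp only [past]
  rw [Finset.sum_coe_sort (Finset.Icc 1 k) (fun i ↦ if i ≤ j then X i ω else 0),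
    ← Finset.sum_filter, position]
  refine Finset.sum_congr ?_ fun _ _ ↦ rfl
  ext i
  simp only [Finset.mem_Icc, Finset.mem_filter]
  omega

lemma measurable_sum_ite_le (j k : ℕ) : Measurable fun x : Finset.Icc 1 k → ℝ ↦
    ∑ i : Finset.Icc 1 k, if (i : ℕ) ≤ j then x i else 0 :=
  Finset.measurable_sum _ fun i _ ↦ by
    split_ifs
    · exact measurable_pi_apply i
    · exact measurable_const

lemma cexp_mul_sign (u : ℝ) {x : ℝ} (hx : x = 1 ∨ x = -1) :
    Complex.exp (u * x * Complex.I) = Real.cos u + x * Real.sin u * Complex.I := by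
  rcases hx with rfl | rfl
  · simp [Complex.exp_mul_I]
  · have : (u : ℂ) * (-1 : ℝ) * Complex.I = (-u : ℂ) * Complex.I := by push_cast; ring
    rw [this, Complex.exp_mul_I]
    simp

namespace IsElephantWalk

variable {p : ℝ} {M : ℕ → Finset ℕ} {X : ℕ → Ω → ℝ}

lemma measurable_position (h : IsElephantWalk μ p M X) (k : ℕ) : Measurable (position X k) :=
  Finset.measurable_sum _ fun i _ ↦ h.measurable i

variable [IsProbabilityMeasure μ]

lemma ae_abs_position_le (h : IsElephantWalk μ p M X) (hM : IsMemory M) (k : ℕ) :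
    ∀ᵐ ω ∂μ, |position X k ω| ≤ k := by
  have : ∀ᵐ ω ∂μ, ∀ i ∈ Finset.Icc 1 k, |X i ω| ≤ 1 :=
    (Finset.eventually_all (Finset.Icc 1 k)).2
      fun i hi ↦ h.ae_abs_le hM (Finset.mem_Icc.1 hi).1
  filter_upwards [this] with ω hω
  refine (Finset.abs_sum_le_sum_abs _ _).trans ((Finset.sum_le_sum hω).trans ?_)
  simp

lemma integrable_position (h : IsElephantWalk μ p M X) (hM : IsMemory M) (k : ℕ) :
    Integrable (position X k) μ :=
  .of_bound (h.measurable_position k).aestronglyMeasurable k (h.ae_abs_position_le hM k)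

lemma integrable_position_sq (h : IsElephantWalk μ p M X) (hM : IsMemory M) (k : ℕ) :
    Integrable (fun ω ↦ position X k ω ^ 2) μ := by
  refine .of_bound ((h.measurable_position k).pow_const 2).aestronglyMeasurable ((k : ℝ) ^ 2) ?_
  filter_upwards [h.ae_abs_position_le hM k] with ω hω
  rw [norm_pow]
  exact pow_le_pow_left₀ (norm_nonneg _) hω 2

/-- An elephant that remembers its whole past `X_1, …, X_k` drifts with mean `(2p - 1) S_k / k`. -/
lemma integral_smul_position (h : IsElephantWalk μ p M X) (hM : IsMemory M) {k : ℕ} (hk : 1 ≤ k)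
    (hfull : M k = Finset.Icc 1 k) {E : Type*} [NormedAddCommGroup E] [NormedSpace ℝ E]
    {G : ℝ → E} (hG : StronglyMeasurable G) (hGi : Integrable (fun ω ↦ G (position X k ω)) μ) :
    ∫ ω, X (k + 1) ω • G (position X k ω) ∂μ =
      (2 * p - 1) • ∫ ω, (position X k ω / k) • G (position X k ω) ∂μ := by
  have hg : StronglyMeasurable fun x : Finset.Icc 1 k → ℝ ↦
      G (∑ i : Finset.Icc 1 k, if (i : ℕ) ≤ k then x i else 0) :=
    hG.comp_measurable (measurable_sum_ite_le k k)
  have := h.integral_smul_past hM hk hg (by simpa only [← position_eq_past X le_rfl] using hGi)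
  simp only [← position_eq_past X le_rfl, hfull, Nat.card_Icc, Nat.add_sub_cancel] at this
  exact this

lemma integral_position_sq_succ (h : IsElephantWalk μ p M X) (hM : IsMemory M) {k : ℕ}
    (hk : 1 ≤ k) (hfull : M k = Finset.Icc 1 k) :
    ∫ ω, position X (k + 1) ω ^ 2 ∂μ =
      (1 + 2 * (2 * p - 1) / k) * ∫ ω, position X k ω ^ 2 ∂μ + 1 := by
  have h1 := h.integral_smul_position hM hk hfull (G := id) stronglyMeasurable_id
    (h.integrable_position hM k)
  have hae : (fun ω ↦ position X (k + 1) ω ^ 2) =ᵐ[μ] fun ω ↦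
      position X k ω ^ 2 + 2 * (X (k + 1) ω • position X k ω) + 1 := by
    filter_upwards [h.ae_sign hM (k := k + 1) (by omega)] with ω hω
    have : X (k + 1) ω ^ 2 = 1 := by rcases hω with hω | hω <;> simp [hω]
    rw [position_succ, smul_eq_mul]
    linear_combination this
  have hi1 := h.integrable_position_sq hM k
  have hi2 := (h.integrable_smul hM (k := k + 1) (by omega)
    (h.integrable_position hM k)).const_mul 2
  have hi12 : Integrable (fun ω ↦ position X k ω ^ 2 + 2 * (X (k + 1) ω • position X k ω)) μ :=
    hi1.add hi2
  rw [integral_congr_ae hae, integral_add hi12 (integrable_const _), integral_add hi1 hi2,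
    integral_const_mul]
  simp only [id] at h1
  rw [h1]
  have : ∀ ω, (position X k ω / k) • position X k ω = (k : ℝ)⁻¹ * position X k ω ^ 2 := by
    intro ω; simp only [smul_eq_mul]; ring
  simp_rw [this, integral_const_mul]
  simp only [smul_eq_mul, integral_const, probReal_univ, mul_one, div_eq_mul_inv]
  ring

/-- The second moment of the position, as long as the whole past is remembered. -/
lemma integral_position_sq_le (h : IsElephantWalk μ p M X) (hM : IsMemory M)
    (ha : -1 < 2 * p - 1) {N : ℕ}
    (hfull : ∀ k, 1 ≤ k → k < N → M k = Finset.Icc 1 k) {k : ℕ} (hk : 1 ≤ k) (hkN : k ≤ N) :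
    ∫ ω, position X k ω ^ 2 ∂μ ≤ varBound (2 * p - 1) k := by
  induction k, hk using Nat.le_induction with
  | base =>
    have : (fun ω ↦ position X 1 ω ^ 2) =ᵐ[μ] fun _ ↦ 1 := by
      filter_upwards [h.ae_sign hM le_rfl] with ω hω
      rw [position_one]
      rcases hω with hω | hω <;> simp [hω]
    rw [integral_congr_ae this, varBound_one ha]
    simp
  | succ k hk ih =>
    rw [h.integral_position_sq_succ hM hk (hfull k hk hkN), varBound_succ ha]
    have h0 : 0 ≤ ∫ ω, position X k ω ^ 2 ∂μ := integral_nonneg fun _ ↦ sq_nonneg _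
    have h1 : 1 + 2 * (2 * p - 1) / k ≤ (1 + (2 * p - 1) / k) ^ 2 := by
      have : (1 + (2 * p - 1) / k) ^ 2 = 1 + 2 * (2 * p - 1) / k + ((2 * p - 1) / k) ^ 2 := by ring
      nlinarith [sq_nonneg ((2 * p - 1) / (k : ℝ))]
    have := mul_le_mul_of_nonneg_right h1 h0
    have := mul_le_mul_of_nonneg_left (ih (by omega)) (sq_nonneg (1 + (2 * p - 1) / (k : ℝ)))
    linarith

/-- One step of the walk, seen through characteristic functions. -/
lemma integral_cexp_position_succ (h : IsElephantWalk μ p M X) (hM : IsMemory M) {k : ℕ}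
    (hk : 1 ≤ k) (hfull : M k = Finset.Icc 1 k) (u : ℝ) :
    ∫ ω, Complex.exp (u * position X (k + 1) ω * Complex.I) ∂μ =
      ∫ ω, Complex.exp (u * position X k ω * Complex.I) *
        (Real.cos u + ((2 * p - 1) * (position X k ω / k) : ℝ) * Real.sin u * Complex.I) ∂μ := by
  let e : ℝ → ℂ := fun x ↦ Complex.exp (u * x * Complex.I)
  have hec : Continuous e := by fun_prop
  have hen : ∀ x, ‖e x‖ ≤ 1 := fun x ↦ by
    simp only [e]
    rw [← Complex.ofReal_mul, Complex.norm_exp_ofReal_mul_I]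
  have hei : Integrable (fun ω ↦ e (position X k ω)) μ :=
    .of_bound (hec.measurable.comp (h.measurable_position k)).aestronglyMeasurable 1
      (ae_of_all _ fun ω ↦ hen _)
  have h1 := h.integral_smul_position hM hk hfull hec.stronglyMeasurable hei
  have hi2 := h.integrable_smul hM (k := k + 1) (by omega) hei
  have hi3 : Integrable (fun ω ↦ (position X k ω / k) • e (position X k ω)) μ := by
    refine hei.bdd_smul 1 ((h.measurable_position k).div_const _).aestronglyMeasurable ?_
    filter_upwards [h.ae_abs_position_le hM k] with ω hω
    rw [Real.norm_eq_abs, abs_div, Nat.abs_cast]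
    exact div_le_one_of_le₀ hω (Nat.cast_nonneg _)
  have hae : (fun ω ↦ Complex.exp (u * position X (k + 1) ω * Complex.I)) =ᵐ[μ] fun ω ↦
      (Real.cos u : ℂ) * e (position X k ω)
        + (Real.sin u * Complex.I) * (X (k + 1) ω • e (position X k ω)) := by
    filter_upwards [h.ae_sign hM (k := k + 1) (by omega)] with ω hω
    rw [position_succ]
    have : (u : ℂ) * ((position X k ω + X (k + 1) ω : ℝ) : ℂ) * Complex.I
        = u * position X k ω * Complex.I + u * X (k + 1) ω * Complex.I := by push_cast; ring
    rw [this, Complex.exp_add, cexp_mul_sign u hω, Complex.real_smul]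
    simp only [e]
    ring
  have hi4 : Integrable (fun ω ↦ (Real.sin u * Complex.I) *
      ((2 * p - 1) • (position X k ω / k) • e (position X k ω))) μ :=
    (hi3.smul (2 * p - 1)).const_mul _
  rw [integral_congr_ae hae, integral_add (hei.const_mul _) (hi2.const_mul _), integral_const_mul,
    integral_const_mul, h1, ← integral_const_mul, ← integral_smul, ← integral_const_mul,
    ← integral_add (hei.const_mul _) hi4]
  refine integral_congr_ae (ae_of_all _ fun ω ↦ ?_)
  simp only [e, Complex.real_smul]
  push_cast
  ring

end IsElephantWalk

end Position

/-! ### Characteristic functions of a walk with full memory -/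

/-- A sign with mean `y` is close to a Gaussian variable with mean `y` and variance `1`, in terms of
characteristic functions near `0`. -/
lemma norm_cos_add_sin_sub_cexp_le (u : ℝ) {y : ℝ} (hy : |y| ≤ 1) :
    ‖((Real.cos u : ℂ) + y * Real.sin u * Complex.I) -
      Complex.exp ((u * y : ℝ) * Complex.I - (u ^ 2 / 2 : ℝ))‖ ≤ 24 * |u| ^ 3 + u ^ 2 * y ^ 2 := by
  -- For `|u| > 1/2` the trivial bound `3` is at most `24 |u|³`.
  rcases le_or_gt |u| (1 / 2) with hu | hu
  · have hu1 : |u| ≤ 1 := by linarith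
    have hu0 := abs_nonneg u
    have hc := Real.cos_bound hu1
    have hs := Real.sin_bound hu1
    set z : ℂ := (u * y : ℝ) * Complex.I - (u ^ 2 / 2 : ℝ) with hz
    have hzn : ‖z‖ ^ 2 = u ^ 2 * y ^ 2 + u ^ 4 / 4 := by
      rw [← Complex.normSq_eq_norm_sq, Complex.normSq_apply]
      simp only [hz, Complex.sub_re, Complex.sub_im, Complex.mul_re, Complex.mul_im,
        Complex.ofReal_re, Complex.ofReal_im, Complex.I_re, Complex.I_im]
      ring
    have hu2 : u ^ 2 = |u| ^ 2 := (sq_abs u).symm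
    have hu4 : u ^ 4 = |u| ^ 4 := by rw [← abs_pow, abs_of_nonneg (by positivity)]
    have hy2 : y ^ 2 ≤ 1 := by rw [← sq_abs]; exact pow_le_one₀ (abs_nonneg _) hy
    have h43 : |u| ^ 4 ≤ |u| ^ 3 := pow_le_pow_of_le_one hu0 hu1 (by norm_num)
    have hz1 : ‖z‖ ≤ 1 := by
      have h2 : |u| ^ 2 ≤ (1 / 2) ^ 2 := pow_le_pow_left₀ hu0 hu 2
      have h4 : |u| ^ 4 ≤ (1 / 2) ^ 4 := pow_le_pow_left₀ hu0 hu 4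
      have : ‖z‖ ^ 2 ≤ 1 ^ 2 := by
        rw [hzn, hu2, hu4]
        nlinarith [mul_le_mul_of_nonneg_left hy2 (sq_nonneg |u|)]
      exact le_of_sq_le_sq this (by norm_num)
    have he := Complex.norm_exp_sub_one_sub_id_le hz1
    rw [hzn] at he
    have hsplit : ((Real.cos u : ℂ) + y * Real.sin u * Complex.I) - Complex.exp z =
        ((Real.cos u - (1 - u ^ 2 / 2) : ℝ) : ℂ)
          + ((y * (Real.sin u - (u - u ^ 3 / 6)) - y * (u ^ 3 / 6) : ℝ) : ℂ) * Complex.I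
          - (Complex.exp z - 1 - z) := by
      rw [hz]; push_cast; ring
    rw [hsplit]
    refine (norm_sub_le _ _).trans ?_
    have h1 : ‖((Real.cos u - (1 - u ^ 2 / 2) : ℝ) : ℂ)‖ ≤ |u| ^ 4 * (5 / 96) := by
      rw [Complex.norm_real]; exact hc
    have h2 : ‖((y * (Real.sin u - (u - u ^ 3 / 6)) - y * (u ^ 3 / 6) : ℝ) : ℂ) * Complex.I‖
        ≤ |u| ^ 4 * (5 / 96) + |u| ^ 3 / 6 := by
      rw [norm_mul, Complex.norm_I, mul_one, Complex.norm_real, Real.norm_eq_abs]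
      refine (abs_sub _ _).trans (add_le_add ?_ ?_)
      · rw [abs_mul]
        refine (mul_le_of_le_one_left (abs_nonneg _) hy).trans (hs.trans ?_)
        have : |u| ^ 5 ≤ |u| ^ 4 := pow_le_pow_of_le_one hu0 hu1 (by norm_num)
        have : 0 ≤ |u| ^ 4 := by positivity
        linarith
      · rw [abs_mul, abs_div, abs_pow, abs_of_pos (by norm_num : (0 : ℝ) < 6)]
        exact mul_le_of_le_one_left (by positivity) hy
    have h3 := norm_add_le ((Real.cos u - (1 - u ^ 2 / 2) : ℝ) : ℂ)
      (((y * (Real.sin u - (u - u ^ 3 / 6)) - y * (u ^ 3 / 6) : ℝ) : ℂ) * Complex.I)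
    have h30 : 0 ≤ |u| ^ 3 := by positivity
    rw [hu4] at he
    linarith
  · have h1 : ‖(Real.cos u : ℂ) + y * Real.sin u * Complex.I‖ ≤ 2 := by
      refine (norm_add_le _ _).trans ?_
      rw [norm_mul, norm_mul, Complex.norm_I, Complex.norm_real, Complex.norm_real,
        Complex.norm_real, Real.norm_eq_abs, Real.norm_eq_abs, Real.norm_eq_abs]
      have := mul_le_one₀ hy (abs_nonneg _) (Real.abs_sin_le_one u)
      linarith [Real.abs_cos_le_one u]
    have h2 : ‖Complex.exp ((u * y : ℝ) * Complex.I - (u ^ 2 / 2 : ℝ))‖ ≤ 1 := by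
      rw [Complex.norm_exp]
      simp only [Complex.sub_re, Complex.mul_re, Complex.ofReal_re, Complex.ofReal_im,
        Complex.I_re, Complex.I_im]
      refine Real.exp_le_one_iff.2 ?_
      nlinarith [sq_nonneg u]
    have h3 : (1 / 2 : ℝ) ^ 3 ≤ |u| ^ 3 := pow_le_pow_left₀ (by norm_num) hu.le 3
    refine (norm_sub_le _ _).trans ?_
    nlinarith [mul_nonneg (sq_nonneg u) (sq_nonneg y)]

/-- The summands of the error when the characteristic function of `S_n / b_n` at `c` is
approximated by that of a Gaussian variable. -/
noncomputable def cltError (a c : ℝ) (j : ℕ) : ℝ :=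
  24 * |c / growth a (j + 1)| ^ 3 + (c / growth a (j + 1)) ^ 2 * (varBound a j / (j : ℝ) ^ 2)

lemma cltError_nonneg (a c : ℝ) (j : ℕ) : 0 ≤ cltError a c j := by
  have := varBound_nonneg a j
  unfold cltError
  positivity

namespace IsElephantWalk

variable {Ω : Type*} [MeasurableSpace Ω] {μ : Measure Ω} [IsProbabilityMeasure μ]
  {p : ℝ} {M : ℕ → Finset ℕ} {X : ℕ → Ω → ℝ}

lemma integrable_cexp_position (h : IsElephantWalk μ p M X) (u : ℝ) (k : ℕ) :
    Integrable (fun ω ↦ Complex.exp (u * position X k ω * Complex.I)) μ := by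
  have hc : Continuous fun x : ℝ ↦ Complex.exp (u * x * Complex.I) := by fun_prop
  refine .of_bound (hc.measurable.comp (h.measurable_position k)).aestronglyMeasurable 1
    (ae_of_all _ fun ω ↦ ?_)
  rw [← Complex.ofReal_mul, Complex.norm_exp_ofReal_mul_I]

/-- The martingale `S_k / b_k` has nearly the characteristic function of a Gaussian variable with
variance `∑_{j ≤ k} b_j⁻²`. The errors of the single steps add up, as the Gaussian factors are
at most `1`. -/
lemma norm_integral_cexp_position_sub_le (h : IsElephantWalk μ p M X) (hM : IsMemory M)
    (hp0 : 0 < p) (hp1 : p < 1) {N : ℕ}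
    (hfull : ∀ k, 1 ≤ k → k < N → M k = Finset.Icc 1 k) (c : ℝ) {k : ℕ} (hk : 1 ≤ k)
    (hkN : k ≤ N) :
    ‖(∫ ω, Complex.exp ((c / growth (2 * p - 1) k : ℝ) * position X k ω * Complex.I) ∂μ) -
      (Real.exp (-(c ^ 2 * invSqSum (2 * p - 1) k / 2)) : ℂ)‖ ≤
      |c| + c ^ 2 / 2 + ∑ j ∈ Finset.range k, cltError (2 * p - 1) c j := by
  set a := 2 * p - 1 with ha_def
  have ha : -1 < a := by linarith
  have ha2 : a ^ 2 ≤ 1 := by nlinarith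
  induction k, hk using Nat.le_induction with
  | base =>
    have hQ : invSqSum a 1 = 1 := by simp [invSqSum, growth_one]
    have hE : ‖(∫ ω, Complex.exp (c * position X 1 ω * Complex.I) ∂μ) - 1‖ ≤ |c| := by
      have : (1 : ℂ) = ∫ _ : Ω, (1 : ℂ) ∂μ := by simp
      rw [this, ← integral_sub (h.integrable_cexp_position c 1) (integrable_const _)]
      refine (norm_integral_le_of_norm_le_const (C := |c|) ?_).trans (by simp)
      filter_upwards [h.ae_sign hM le_rfl] with ω hω
      have h1 := Real.norm_exp_I_mul_ofReal_sub_one_le (x := c * position X 1 ω)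
      have h2 : ‖c * position X 1 ω‖ = |c| := by
        rw [position_one]; rcases hω with hω | hω <;> simp [hω]
      rw [h2] at h1
      refine le_of_eq_of_le ?_ h1
      congr 3; push_cast; ring
    have hG : ‖(1 : ℂ) - (Real.exp (-(c ^ 2 / 2)) : ℂ)‖ ≤ c ^ 2 / 2 := by
      rw [← Complex.ofReal_one, ← Complex.ofReal_sub, Complex.norm_real, Real.norm_eq_abs,
        abs_of_nonneg]
      · linarith [Real.add_one_le_exp (-(c ^ 2 / 2))]
      · have : Real.exp (-(c ^ 2 / 2)) ≤ 1 := Real.exp_le_one_iff.2 (by nlinarith [sq_nonneg c])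
        linarith
    rw [hQ, growth_one, div_one, mul_one]
    have h3 := Finset.sum_nonneg fun j (_ : j ∈ Finset.range 1) ↦ cltError_nonneg a c j
    have h4 := norm_sub_le_norm_sub_add_norm_sub
      (∫ ω, Complex.exp (c * position X 1 ω * Complex.I) ∂μ) 1 (Real.exp (-(c ^ 2 / 2)) : ℂ)
    linarith
  | succ k hk ih =>
    have hfk := hfull k hk hkN
    set u := c / growth a (k + 1) with hu
    have hk0 : (0 : ℝ) < k := by exact_mod_cast hk
    have hrec : u * (1 + a / k) = c / growth a k := by
      rw [hu, growth_succ, div_mul_eq_mul_div, mul_div_mul_right _ _ (one_add_div_pos ha k).ne']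
    have hQ : c ^ 2 * invSqSum a (k + 1) / 2 = c ^ 2 * invSqSum a k / 2 + u ^ 2 / 2 := by
      rw [invSqSum_succ, hu, div_pow]; ring
    -- replacing the step by a Gaussian one
    have hstep : ‖(∫ ω, Complex.exp (u * position X (k + 1) ω * Complex.I) ∂μ) -
        Real.exp (-(u ^ 2 / 2)) *
          ∫ ω, Complex.exp ((c / growth a k : ℝ) * position X k ω * Complex.I) ∂μ‖
        ≤ cltError a c k := by
      have hi1 : Integrable (fun ω ↦ Complex.exp (u * position X k ω * Complex.I) *
          (Real.cos u + (a * (position X k ω / k) : ℝ) * Real.sin u * Complex.I)) μ := by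
        refine (h.integrable_cexp_position u k).mul_bdd (c := 1 + |a|) ?_ ?_
        · have hc : Continuous fun x : ℝ ↦
              ((Real.cos u : ℂ) + (a * (x / k) : ℝ) * Real.sin u * Complex.I) := by fun_prop
          exact (hc.measurable.comp (h.measurable_position k)).aestronglyMeasurable
        · filter_upwards [h.ae_abs_position_le hM k] with ω hω
          refine (norm_add_le _ _).trans (add_le_add ?_ ?_)
          · rw [Complex.norm_real]; exact Real.abs_cos_le_one u
          · rw [norm_mul, norm_mul, Complex.norm_I, Complex.norm_real, Complex.norm_real,
              Real.norm_eq_abs, Real.norm_eq_abs, mul_one, abs_mul, abs_div, Nat.abs_cast]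
            have h1 : |position X k ω| / k ≤ 1 := div_le_one_of_le₀ hω hk0.le
            have h2 := Real.abs_sin_le_one u
            calc |a| * (|position X k ω| / k) * |Real.sin u| ≤ |a| * 1 * 1 := by gcongr
              _ = |a| := by ring
      rw [h.integral_cexp_position_succ hM hk hfk, ← integral_const_mul,
        ← integral_sub hi1 ((h.integrable_cexp_position _ k).const_mul _)]
      have hi3 : Integrable (fun ω ↦ 24 * |u| ^ 3 + u ^ 2 * (a ^ 2 / k ^ 2 * position X k ω ^ 2))
          μ := (integrable_const _).add (((h.integrable_position_sq hM k).const_mul _).const_mul _)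
      refine (norm_integral_le_of_norm_le hi3 ?_).trans ?_
      · filter_upwards [h.ae_abs_position_le hM k] with ω hω
        set s := position X k ω
        have hy : |a * (s / k)| ≤ 1 := by
          rw [abs_mul, abs_div, Nat.abs_cast]
          have h1 : |s| / k ≤ 1 := div_le_one_of_le₀ hω hk0.le
          have h2 : |a| ≤ 1 := (sq_le_one_iff_abs_le_one a).1 ha2
          exact mul_le_one₀ h2 (by positivity) h1
        have hfac : (Real.exp (-(u ^ 2 / 2)) : ℂ) *
            Complex.exp ((c / growth a k : ℝ) * s * Complex.I) =
            Complex.exp (u * s * Complex.I) *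
              Complex.exp ((u * (a * (s / k)) : ℝ) * Complex.I - (u ^ 2 / 2 : ℝ)) := by
          rw [Complex.ofReal_exp, ← Complex.exp_add, ← Complex.exp_add, ← hrec]
          congr 1
          push_cast
          ring
        rw [hfac, ← mul_sub, norm_mul, ← Complex.ofReal_mul, Complex.norm_exp_ofReal_mul_I, one_mul]
        refine (norm_cos_add_sin_sub_cexp_le u hy).trans (le_of_eq ?_)
        ring
      · rw [integral_add (integrable_const _)
          (((h.integrable_position_sq hM k).const_mul _).const_mul _),
          integral_const_mul (u ^ 2), integral_const_mul (a ^ 2 / (k : ℝ) ^ 2)]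
        have hv := h.integral_position_sq_le hM ha hfull hk (by omega)
        have h0 : 0 ≤ ∫ ω, position X k ω ^ 2 ∂μ := integral_nonneg fun _ ↦ sq_nonneg _
        simp only [integral_const, probReal_univ, smul_eq_mul, one_mul, cltError, ← hu]
        have : a ^ 2 / (k : ℝ) ^ 2 * ∫ ω, position X k ω ^ 2 ∂μ ≤ varBound a k / (k : ℝ) ^ 2 := by
          rw [div_mul_eq_mul_div]
          gcongr
          nlinarith
        gcongr
    have hexp : (Real.exp (-(c ^ 2 * invSqSum a (k + 1) / 2)) : ℂ) =
        Real.exp (-(u ^ 2 / 2)) * Real.exp (-(c ^ 2 * invSqSum a k / 2)) := by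
      rw [← Complex.ofReal_mul, ← Real.exp_add, hQ]
      congr 2; ring
    have hle1 : ‖(Real.exp (-(u ^ 2 / 2)) : ℂ)‖ ≤ 1 := by
      rw [Complex.norm_real, Real.norm_eq_abs, abs_of_pos (Real.exp_pos _), Real.exp_le_one_iff]
      nlinarith [sq_nonneg u]
    have h4 := norm_sub_le_norm_sub_add_norm_sub
      (∫ ω, Complex.exp (u * position X (k + 1) ω * Complex.I) ∂μ)
      (Real.exp (-(u ^ 2 / 2)) *
          ∫ ω, Complex.exp ((c / growth a k : ℝ) * position X k ω * Complex.I) ∂μ)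
      (Real.exp (-(c ^ 2 * invSqSum a (k + 1) / 2)) : ℂ)
    have h5 := ih (by omega)
    rw [hexp, ← mul_sub, norm_mul] at h4
    rw [hexp, Finset.sum_range_succ]
    have h6 := mul_le_of_le_one_left (norm_nonneg
      ((∫ ω, Complex.exp ((c / growth a k : ℝ) * position X k ω * Complex.I) ∂μ) -
        (Real.exp (-(c ^ 2 * invSqSum a k / 2)) : ℂ))) hle1
    linarith

end IsElephantWalk

/-! ### Asymptotics of the normalising sequences -/

section Asymptotics

variable {a : ℝ}

lemma prod_range_one_add_add (a : ℝ) (n : ℕ) :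
    ∏ j ∈ Finset.range (n + 1), (1 + a + j) = ((n + 1).factorial : ℝ) * growth a (n + 2) := by
  induction n with
  | zero => simp [growth, Finset.prod_range_succ]
  | succ n ih =>
    rw [Finset.prod_range_succ, ih, growth_succ a (n + 2), Nat.factorial_succ (n + 1)]
    have : (n : ℝ) + 2 ≠ 0 := by positivity
    push_cast
    field_simp
    ring

/-- Euler's limit formula for the Gamma function gives `b_n ~ n ^ a / Γ(1 + a)`. -/
lemma tendsto_growth_div_rpow (ha : -1 < a) :
    Tendsto (fun n : ℕ ↦ growth a n / (n : ℝ) ^ a) atTop (𝓝 (Real.Gamma (1 + a))⁻¹) := by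
  rw [← tendsto_add_atTop_iff_nat 2]
  have hG := (Real.GammaSeq_tendsto_Gamma (1 + a)).inv₀ (Real.Gamma_pos_of_pos (by linarith)).ne'
  have h1 : Tendsto (fun n : ℕ ↦ (n : ℝ) / (n + 1)) atTop (𝓝 1) := tendsto_natCast_div_add_atTop 1
  have h2 : Tendsto (fun n : ℕ ↦ ((n : ℝ) / (n + 2)) ^ a) atTop (𝓝 1) := by
    have := (tendsto_natCast_div_add_atTop (2 : ℝ)).rpow_const (p := a) (Or.inl one_ne_zero)
    simpa using this
  have := (hG.mul h1).mul h2
  rw [mul_one, mul_one] at this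
  refine this.congr' ?_
  filter_upwards [eventually_ge_atTop 1] with n hn
  have hn0 : (0 : ℝ) < n := by exact_mod_cast hn
  have hg := growth_pos ha (n + 2)
  rw [Real.GammaSeq, prod_range_one_add_add, Real.div_rpow hn0.le (by positivity),
    Real.rpow_add hn0, Real.rpow_one, Nat.factorial_succ]
  have h3 : (n.factorial : ℝ) ≠ 0 := by positivity
  have h4 : (n : ℝ) ^ a ≠ 0 := (Real.rpow_pos_of_pos hn0 a).ne'
  have h5 : ((n : ℝ) + 2) ^ a ≠ 0 := (Real.rpow_pos_of_pos (by positivity) a).ne'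
  have h6 : (n : ℝ) + 1 ≠ 0 := by positivity
  push_cast
  field_simp

lemma tendsto_inv_growth_sq_mul_rpow (ha : -1 < a) :
    Tendsto (fun k : ℕ ↦ (growth a (k + 1) ^ 2)⁻¹ * ((k + 1 : ℕ) : ℝ) ^ (2 * a)) atTop
      (𝓝 (Real.Gamma (1 + a) ^ 2)) := by
  have h := (((tendsto_growth_div_rpow ha).comp (tendsto_add_atTop_nat 1)).inv₀
    (inv_ne_zero (Real.Gamma_pos_of_pos (by linarith)).ne')).pow 2
  rw [inv_inv] at h
  refine h.congr fun k ↦ ?_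
  have hk : (0 : ℝ) ≤ ((k + 1 : ℕ) : ℝ) := Nat.cast_nonneg _
  simp only [Function.comp_apply]
  rw [inv_div, div_pow, mul_comm 2 a, Real.rpow_mul hk, Real.rpow_two, div_eq_mul_inv, mul_comm]

lemma isTheta_inv_growth_sq (ha : -1 < a) :
    (fun k : ℕ ↦ (growth a (k + 1) ^ 2)⁻¹) =Θ[atTop]
      fun k : ℕ ↦ ((k + 1 : ℕ) : ℝ) ^ (-(2 * a)) := by
  have hG : Real.Gamma (1 + a) ^ 2 ≠ 0 :=
    pow_ne_zero _ (Real.Gamma_pos_of_pos (by linarith)).ne'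
  have : Tendsto (fun k : ℕ ↦ (growth a (k + 1) ^ 2)⁻¹ / ((k + 1 : ℕ) : ℝ) ^ (-(2 * a))) atTop
      (𝓝 (Real.Gamma (1 + a) ^ 2)) := by
    refine (tendsto_inv_growth_sq_mul_rpow ha).congr fun k ↦ ?_
    rw [Real.rpow_neg (Nat.cast_nonneg _), div_inv_eq_mul]
  exact (Asymptotics.isTheta_of_div_tendsto_nhds_ne_zero this hG).symm

lemma summable_inv_growth_sq_iff (ha : -1 < a) :
    Summable (fun k : ℕ ↦ (growth a (k + 1) ^ 2)⁻¹) ↔ 1 / 2 < a := by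
  have h := isTheta_inv_growth_sq ha
  have h1 : Summable (fun k : ℕ ↦ (growth a (k + 1) ^ 2)⁻¹) ↔
      Summable fun k : ℕ ↦ ((k + 1 : ℕ) : ℝ) ^ (-(2 * a)) :=
    ⟨fun hs ↦ summable_of_isBigO_nat hs h.isBigO_symm, fun hs ↦ summable_of_isBigO_nat hs h.isBigO⟩
  rw [h1, summable_nat_add_iff (f := fun n : ℕ ↦ (n : ℝ) ^ (-(2 * a))) 1, Real.summable_nat_rpow]
  constructor <;> intro <;> linarith

lemma tendsto_invSqSum_atTop (ha : -1 < a) (ha' : a ≤ 1 / 2) :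
    Tendsto (invSqSum a) atTop atTop :=
  (not_summable_iff_tendsto_nat_atTop_of_nonneg fun _ ↦ by positivity).1
    ((summable_inv_growth_sq_iff ha).not.2 ha'.not_gt)

lemma tendsto_varBound_div_of_lt (ha : -1 < a) (ha' : a < 1 / 2) :
    Tendsto (fun n : ℕ ↦ varBound a n / n) atTop (𝓝 (1 - 2 * a)⁻¹) := by
  have hQ := tendsto_invSqSum_atTop ha ha'.le
  -- `n / b_n²` has the increments `(1 - 2a - a² / k) b_{k+1}⁻²`
  let y : ℕ → ℝ := fun n ↦ n * (growth a n ^ 2)⁻¹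
  have hf : (fun k : ℕ ↦ y (k + 1) - y k - (1 - 2 * a) * (growth a (k + 1) ^ 2)⁻¹) =o[atTop]
      fun k : ℕ ↦ (growth a (k + 1) ^ 2)⁻¹ := by
    have h0 : Tendsto (fun k : ℕ ↦ -(a ^ 2 / k)) atTop (𝓝 0) := by
      simpa using (tendsto_const_div_atTop_nhds_zero_nat (a ^ 2)).neg
    have : (fun k : ℕ ↦ -(a ^ 2 / k) * (growth a (k + 1) ^ 2)⁻¹) =o[atTop]
        fun k : ℕ ↦ 1 * (growth a (k + 1) ^ 2)⁻¹ :=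
      ((Asymptotics.isLittleO_one_iff ℝ).2 h0).mul_isBigO (Asymptotics.isBigO_refl _ _)
    simp only [one_mul] at this
    refine this.congr' ?_ EventuallyEq.rfl
    filter_upwards [eventually_ge_atTop 1] with k hk
    have hk0 : (k : ℝ) ≠ 0 := by positivity
    have hg := (growth_pos ha k).ne'
    have h1 := (one_add_div_pos ha k).ne'
    have h2 : (growth a k ^ 2)⁻¹ = (growth a (k + 1) ^ 2)⁻¹ * (1 + a / k) ^ 2 := by
      rw [growth_succ, mul_pow, mul_inv, mul_assoc, inv_mul_cancel₀ (pow_ne_zero 2 h1), mul_one]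
    simp only [y, h2]
    push_cast
    field_simp
    ring
  have hs := hf.sum_range (fun _ ↦ by positivity) hQ
  have hy : ∀ n, ∑ k ∈ Finset.range n,
      (y (k + 1) - y k - (1 - 2 * a) * (growth a (k + 1) ^ 2)⁻¹) =
      y n - (1 - 2 * a) * invSqSum a n := by
    intro n
    rw [Finset.sum_sub_distrib, Finset.sum_range_sub, ← Finset.mul_sum, invSqSum]
    simp [y]
  have ht := hs.tendsto_div_nhds_zero
  simp only [hy] at ht
  have ht2 : Tendsto (fun n ↦ y n / invSqSum a n) atTop (𝓝 (1 - 2 * a)) := by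
    have := ht.add_const (1 - 2 * a)
    rw [zero_add] at this
    refine this.congr' ?_
    filter_upwards [hQ.eventually_gt_atTop 0] with n hn
    change (y n - (1 - 2 * a) * invSqSum a n) / invSqSum a n + (1 - 2 * a) = _
    field_simp
    ring
  refine (ht2.inv₀ (by linarith)).congr fun n ↦ ?_
  simp only [y, varBound]
  rw [inv_div, ← div_div, div_inv_eq_mul, div_mul_eq_mul_div, mul_comm]

lemma tendsto_varBound_div_log : Tendsto
    (fun n : ℕ ↦ varBound (1 / 2) n / (n * Real.log n)) atTop (𝓝 1) := by
  have ha : (-1 : ℝ) < 1 / 2 := by norm_num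
  set Γ := Real.Gamma (1 + 1 / 2) with hΓ
  have hΓ0 : Γ ≠ 0 := (Real.Gamma_pos_of_pos (by norm_num)).ne'
  have hlog : Tendsto (fun n : ℕ ↦ Real.log n) atTop atTop :=
    Real.tendsto_log_atTop.comp tendsto_natCast_atTop_atTop
  have hH : ∀ n : ℕ, (harmonic n : ℝ) = ∑ k ∈ Finset.range n, ((k + 1 : ℕ) : ℝ)⁻¹ := by
    intro n; simp [harmonic]
  have hHlog : Tendsto (fun n : ℕ ↦ (harmonic n : ℝ) / Real.log n) atTop (𝓝 1) := by
    have := (Real.tendsto_harmonic_sub_log.div_atTop hlog).add_const 1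
    rw [zero_add] at this
    refine this.congr' ?_
    filter_upwards [hlog.eventually_gt_atTop 0] with n hn
    field_simp
    ring
  have hHtop : Tendsto (fun n : ℕ ↦ ∑ k ∈ Finset.range n, ((k + 1 : ℕ) : ℝ)⁻¹) atTop atTop := by
    have := hHlog.pos_mul_atTop one_pos hlog
    refine this.congr' ?_
    filter_upwards [hlog.eventually_gt_atTop 0] with n hn
    rw [← hH, div_mul_cancel₀ _ hn.ne']
  have hf : (fun k : ℕ ↦ (growth (1 / 2) (k + 1) ^ 2)⁻¹ - Γ ^ 2 * ((k + 1 : ℕ) : ℝ)⁻¹) =o[atTop]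
      fun k : ℕ ↦ ((k + 1 : ℕ) : ℝ)⁻¹ := by
    have h0 := (tendsto_inv_growth_sq_mul_rpow ha).sub_const (Γ ^ 2)
    rw [← hΓ, sub_self] at h0
    have := ((Asymptotics.isLittleO_one_iff ℝ).2 h0).mul_isBigO
      (Asymptotics.isBigO_refl (fun k : ℕ ↦ ((k + 1 : ℕ) : ℝ)⁻¹) atTop)
    simp only [one_mul] at this
    refine this.congr_left fun k ↦ ?_
    have hk : ((k + 1 : ℕ) : ℝ) ≠ 0 := by positivity
    rw [mul_one_div_cancel two_ne_zero, Real.rpow_one, sub_mul, mul_inv_cancel_right₀ hk]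
  have ht := (hf.sum_range (fun _ ↦ by positivity) hHtop).tendsto_div_nhds_zero
  have hQ : Tendsto (fun n : ℕ ↦ invSqSum (1 / 2) n / Real.log n) atTop (𝓝 (Γ ^ 2)) := by
    have := (ht.add_const (Γ ^ 2)).mul hHlog
    rw [zero_add, mul_one] at this
    refine this.congr' ?_
    filter_upwards [hHtop.eventually_gt_atTop 0, hlog.eventually_gt_atTop 0] with n hn hl
    rw [Finset.sum_sub_distrib, ← Finset.mul_sum, ← hH]
    rw [← hH] at hn
    change ((invSqSum (1 / 2) n - Γ ^ 2 * (harmonic n : ℝ)) / (harmonic n : ℝ) + Γ ^ 2) *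
      ((harmonic n : ℝ) / Real.log n) = _
    field_simp
    ring
  have := ((tendsto_growth_div_rpow ha).pow 2).mul hQ
  rw [← hΓ, inv_pow, inv_mul_cancel₀ (pow_ne_zero 2 hΓ0)] at this
  refine this.congr fun n ↦ ?_
  rw [div_pow, ← Real.rpow_natCast, ← Real.rpow_natCast, ← Real.rpow_mul (Nat.cast_nonneg n),
    div_mul_div_comm, varBound]
  norm_num

lemma exists_tendsto_varBound_div_rpow (ha : 1 / 2 < a) :
    ∃ v, Tendsto (fun n : ℕ ↦ varBound a n / ((n : ℝ) ^ a) ^ 2) atTop (𝓝 v) := by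
  have ha1 : -1 < a := by linarith
  have hs := ((summable_inv_growth_sq_iff ha1).2 ha).hasSum.tendsto_sum_nat
  refine ⟨_, (((tendsto_growth_div_rpow ha1).pow 2).mul hs).congr fun n ↦ ?_⟩
  rw [varBound, div_pow, div_mul_eq_mul_div, invSqSum]

/-- The errors of all steps together are negligible: each is small compared to the share `b_j⁻²`
of its step in the total variance. -/
lemma tendsto_cltError_sum (ha : -1 < a) (hQ : Tendsto (invSqSum a) atTop atTop)
    (hV : Tendsto (varBound a) atTop atTop)
    (hV2 : Tendsto (fun n : ℕ ↦ varBound a n / (n : ℝ) ^ 2) atTop (𝓝 0))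
    {c : ℕ → ℝ} {C : ℝ} (hc : ∀ᶠ n in atTop, c n ^ 2 * invSqSum a n ≤ C) :
    Tendsto (fun n ↦ |c n| + c n ^ 2 / 2 + ∑ j ∈ Finset.range n, cltError a (c n) j) atTop
      (𝓝 0) := by
  have hc2 : Tendsto (fun n ↦ c n ^ 2) atTop (𝓝 0) := by
    refine squeeze_zero' (.of_forall fun _ ↦ sq_nonneg _) ?_
      ((tendsto_const_nhds (x := C)).div_atTop hQ)
    filter_upwards [hc, hQ.eventually_gt_atTop 0] with n h1 h2
    rwa [le_div_iff₀ h2]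
  have hc1 : Tendsto (fun n ↦ |c n|) atTop (𝓝 0) := by
    have := hc2.sqrt
    simpa only [Real.sqrt_sq_eq_abs, Real.sqrt_zero] using this
  have hmain : Tendsto (fun n ↦ ∑ j ∈ Finset.range n, cltError a (c n) j) atTop (𝓝 0) := by
    let w : ℕ → ℝ := fun j ↦ 24 * √(C / varBound a (j + 1)) + varBound a j / (j : ℝ) ^ 2
    have hw : Tendsto w atTop (𝓝 0) := by
      have := (((tendsto_const_nhds (x := C)).div_atTop
        (hV.comp (tendsto_add_atTop_nat 1))).sqrt.const_mul 24).add hV2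
      simpa using this
    have hwG : (fun j ↦ w j * (growth a (j + 1) ^ 2)⁻¹) =o[atTop]
        fun j ↦ (growth a (j + 1) ^ 2)⁻¹ := by
      have := ((Asymptotics.isLittleO_one_iff ℝ).2 hw).mul_isBigO
        (Asymptotics.isBigO_refl (fun j ↦ (growth a (j + 1) ^ 2)⁻¹) atTop)
      simpa only [one_mul] using this
    have ht := ((hwG.sum_range (fun _ ↦ by positivity) hQ).tendsto_div_nhds_zero).const_mul C
    rw [mul_zero] at ht
    refine squeeze_zero' (.of_forall fun n ↦ Finset.sum_nonneg fun j _ ↦ cltError_nonneg _ _ _)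
      ?_ ht
    filter_upwards [hc, hQ.eventually_gt_atTop 0] with n h1 h2
    have hw0 : ∀ j, 0 ≤ w j := fun j ↦ by
      have := varBound_nonneg a j
      simp only [w]; positivity
    have hle : ∀ j ∈ Finset.range n,
        cltError a (c n) j ≤ c n ^ 2 * (w j * (growth a (j + 1) ^ 2)⁻¹) := by
      intro j hj
      have hg := growth_pos ha (j + 1)
      have hq : 0 < invSqSum a (j + 1) := by
        rw [invSqSum_succ]
        exact add_pos_of_nonneg_of_pos (invSqSum_nonneg _ _) (by positivity)
      -- `c_n² b_{j+1}⁻² = c_n² ∑_{i ≤ j+1} b_i⁻² / varBound a (j + 1)`, and the sum grows with `j`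
      have hsq : |c n / growth a (j + 1)| ≤ √(C / varBound a (j + 1)) := by
        refine Real.le_sqrt_of_sq_le ?_
        rw [sq_abs, varBound, div_pow, div_le_div_iff₀ (by positivity) (by positivity)]
        have h3 : c n ^ 2 * invSqSum a (j + 1) ≤ C :=
          (mul_le_mul_of_nonneg_left (invSqSum_mono a (Finset.mem_range.1 hj))
            (sq_nonneg _)).trans h1
        nlinarith [mul_le_mul_of_nonneg_left h3 (sq_nonneg (growth a (j + 1)))]
      have h4 : |c n / growth a (j + 1)| ^ 2 = c n ^ 2 * (growth a (j + 1) ^ 2)⁻¹ := by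
        rw [sq_abs, div_pow, div_eq_mul_inv]
      have h5 : (c n / growth a (j + 1)) ^ 2 = c n ^ 2 * (growth a (j + 1) ^ 2)⁻¹ := by
        rw [div_pow, div_eq_mul_inv]
      have h6 : cltError a (c n) j = (c n ^ 2 * (growth a (j + 1) ^ 2)⁻¹) *
          (24 * |c n / growth a (j + 1)| + varBound a j / (j : ℝ) ^ 2) := by
        rw [cltError, pow_succ, h4, h5]; ring
      rw [h6, mul_comm (w j), ← mul_assoc]
      gcongr
      simp only [w]
      gcongr
    refine (Finset.sum_le_sum hle).trans ?_
    rw [← Finset.mul_sum]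
    have h7 : c n ^ 2 ≤ C / invSqSum a n := by rwa [le_div_iff₀ h2]
    have h8 : 0 ≤ ∑ j ∈ Finset.range n, w j * (growth a (j + 1) ^ 2)⁻¹ :=
      Finset.sum_nonneg fun j _ ↦ mul_nonneg (hw0 j) (by positivity)
    refine (mul_le_mul_of_nonneg_right h7 h8).trans (le_of_eq ?_)
    rw [invSqSum]
    ring
  simpa using (hc1.add (hc2.div_const 2)).add hmain

end Asymptotics

/-! ### From the remembered steps to the whole walk -/

section Reduction

variable {Ω : Type*} [MeasurableSpace Ω] {μ : Measure Ω} [IsProbabilityMeasure μ]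

lemma integral_abs_le_sqrt {f : Ω → ℝ} (hf : Integrable f μ)
    (hf2 : Integrable (fun ω ↦ f ω ^ 2) μ) : ∫ ω, |f ω| ∂μ ≤ √(∫ ω, f ω ^ 2 ∂μ) := by
  refine Real.le_sqrt_of_sq_le ?_
  set c := ∫ ω, |f ω| ∂μ
  have h1 : ∫ ω, (f ω ^ 2 - 2 * c * |f ω| + c ^ 2) ∂μ = ∫ ω, f ω ^ 2 ∂μ - c ^ 2 := by
    have hi : Integrable (fun ω ↦ f ω ^ 2 - 2 * c * |f ω|) μ := hf2.sub (hf.abs.const_mul _)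
    rw [integral_add hi (integrable_const _), integral_sub hf2 (hf.abs.const_mul _),
      integral_const_mul]
    simp only [integral_const, probReal_univ, one_smul]
    ring
  have h2 : 0 ≤ ∫ ω, (f ω ^ 2 - 2 * c * |f ω| + c ^ 2) ∂μ :=
    integral_nonneg fun ω ↦ by
      have : f ω ^ 2 - 2 * c * |f ω| + c ^ 2 = (|f ω| - c) ^ 2 := by rw [sub_sq, sq_abs]; ring
      simp only [this]; positivity
  linarith

lemma norm_integral_cexp_sub_le {f g : Ω → ℝ} (hf : Integrable f μ) (hg : Integrable g μ) :
    ‖(∫ ω, Complex.exp (f ω * Complex.I) ∂μ) - ∫ ω, Complex.exp (g ω * Complex.I) ∂μ‖ ≤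
      ∫ ω, |f ω - g ω| ∂μ := by
  have hi : ∀ {f : Ω → ℝ}, Integrable f μ →
      Integrable (fun ω ↦ Complex.exp (f ω * Complex.I)) μ := by
    intro f hf
    have hc : Continuous fun x : ℝ ↦ Complex.exp (x * Complex.I) := by fun_prop
    exact .of_bound (hc.comp_aestronglyMeasurable hf.aestronglyMeasurable) 1
      (ae_of_all _ fun ω ↦ (Complex.norm_exp_ofReal_mul_I _).le)
  rw [← integral_sub (hi hf) (hi hg)]
  refine norm_integral_le_of_norm_le (hf.sub hg).abs (ae_of_all _ fun ω ↦ ?_)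
  have h1 : Complex.exp (f ω * Complex.I) - Complex.exp (g ω * Complex.I) =
      Complex.exp (g ω * Complex.I) * (Complex.exp (Complex.I * (f ω - g ω : ℝ)) - 1) := by
    rw [mul_sub, ← Complex.exp_add, mul_one]
    congr 2
    push_cast
    ring
  rw [h1, norm_mul, Complex.norm_exp_ofReal_mul_I, one_mul]
  exact Real.norm_exp_I_mul_ofReal_sub_one_le

/-- The deviation of the walk with memory `{1, …, m}` at time `k ≥ m` from its conditional mean,
given the first `m` steps. -/
noncomputable def fluctuation (p : ℝ) (m : ℕ) (X : ℕ → Ω → ℝ) (k : ℕ) (ω : Ω) : ℝ :=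
  position X k ω - position X m ω - ((k : ℝ) - m) * ((2 * p - 1) * (position X m ω / m))

namespace IsElephantWalk

variable {p : ℝ} {m : ℕ} {X : ℕ → Ω → ℝ}

omit [IsProbabilityMeasure μ] in
lemma measurable_fluctuation {M : ℕ → Finset ℕ} (h : IsElephantWalk μ p M X) (k : ℕ) :
    Measurable (fluctuation p m X k) :=
  ((h.measurable_position k).sub (h.measurable_position m)).sub
    ((((h.measurable_position m).div_const _).const_mul _).const_mul _)

lemma ae_abs_position_div_le {M : ℕ → Finset ℕ} (h : IsElephantWalk μ p M X) (hM : IsMemory M)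
    (hp0 : 0 < p) (hp1 : p < 1) (k : ℕ) :
    ∀ᵐ ω ∂μ, |(2 * p - 1) * (position X k ω / k)| ≤ 1 := by
  filter_upwards [h.ae_abs_position_le hM k] with ω hω
  rw [abs_mul, abs_div, Nat.abs_cast]
  exact mul_le_one₀ (abs_le.2 ⟨by linarith, by linarith⟩) (by positivity)
    (div_le_one_of_le₀ hω (Nat.cast_nonneg _))

lemma exists_ae_abs_fluctuation_le {M : ℕ → Finset ℕ} (h : IsElephantWalk μ p M X)
    (hM : IsMemory M) (hp0 : 0 < p) (hp1 : p < 1) (k : ℕ) :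
    ∃ C : ℝ, ∀ᵐ ω ∂μ, |fluctuation p m X k ω| ≤ C := by
  refine ⟨k + m + |(k : ℝ) - m|, ?_⟩
  filter_upwards [h.ae_abs_position_le hM k, h.ae_abs_position_le hM m,
    h.ae_abs_position_div_le hM hp0 hp1 m] with ω h1 h2 h3
  refine (abs_sub _ _).trans (add_le_add ((abs_sub _ _).trans (add_le_add h1 h2)) ?_)
  rw [abs_mul]
  exact mul_le_of_le_one_right (abs_nonneg _) h3

lemma integrable_fluctuation {M : ℕ → Finset ℕ} (h : IsElephantWalk μ p M X)
    (hM : IsMemory M) (hp0 : 0 < p) (hp1 : p < 1) (k : ℕ) :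
    Integrable (fluctuation p m X k) μ := by
  obtain ⟨C, hC⟩ := h.exists_ae_abs_fluctuation_le (m := m) hM hp0 hp1 k
  exact .of_bound (h.measurable_fluctuation k).aestronglyMeasurable C hC

lemma integrable_fluctuation_sq {M : ℕ → Finset ℕ} (h : IsElephantWalk μ p M X)
    (hM : IsMemory M) (hp0 : 0 < p) (hp1 : p < 1) (k : ℕ) :
    Integrable (fun ω ↦ fluctuation p m X k ω ^ 2) μ := by
  obtain ⟨C, hC⟩ := h.exists_ae_abs_fluctuation_le (m := m) hM hp0 hp1 k
  refine .of_bound ((h.measurable_fluctuation k).pow_const 2).aestronglyMeasurable (C ^ 2) ?_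
  filter_upwards [hC] with ω hω
  rw [norm_pow]
  exact pow_le_pow_left₀ (norm_nonneg _) hω 2

/-- After time `m` the deviations of the single steps from their conditional means are orthogonal,
so that the second moment of their sum grows only linearly. -/
lemma integral_fluctuation_sq_le (h : IsElephantWalk μ p (firstSteps m) X)
    (hp0 : 0 < p) (hp1 : p < 1) (hm : 1 ≤ m) {k : ℕ} (hk : m ≤ k) :
    ∫ ω, fluctuation p m X k ω ^ 2 ∂μ ≤ 4 * (k - m) := by
  have hM := isMemory_firstSteps hm
  induction k, hk using Nat.le_induction with
  | base => simp [fluctuation]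
  | succ k hk ih =>
    have hk1 : 1 ≤ k := hm.trans hk
    let q : Ω → ℝ := fun ω ↦ (2 * p - 1) * (position X m ω / m)
    have hqm : Measurable q := ((h.measurable_position m).div_const _).const_mul _
    have hT := h.integrable_fluctuation (m := m) hM hp0 hp1 k
    have horth : ∫ ω, X (k + 1) ω * fluctuation p m X k ω ∂μ
        = ∫ ω, q ω * fluctuation p m X k ω ∂μ := by
      let g : (Finset.Icc 1 k → ℝ) → ℝ := fun x ↦
        (∑ i : Finset.Icc 1 k, if (i : ℕ) ≤ k then x i else 0) -
        (∑ i : Finset.Icc 1 k, if (i : ℕ) ≤ m then x i else 0) - ((k : ℝ) - m) *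
          ((2 * p - 1) * ((∑ i : Finset.Icc 1 k, if (i : ℕ) ≤ m then x i else 0) / m))
      have hg : Measurable g := ((measurable_sum_ite_le k k).sub (measurable_sum_ite_le m k)).sub
        ((((measurable_sum_ite_le m k).div_const _).const_mul _).const_mul _)
      have hgT : ∀ ω, g (past X k ω) = fluctuation p m X k ω := fun ω ↦ by
        simp only [g, fluctuation, ← position_eq_past X le_rfl, ← position_eq_past X hk]
      have := h.integral_smul_past hM hk1 hg.stronglyMeasurable (by simpa only [hgT] using hT)
      simp only [hgT, firstSteps, min_eq_right hk, Nat.card_Icc, Nat.add_sub_cancel,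
        smul_eq_mul] at this
      rw [this, ← integral_const_mul]
      refine integral_congr_ae (ae_of_all _ fun ω ↦ ?_)
      simp only [q, position]
      ring
    have hqle := h.ae_abs_position_div_le hM hp0 hp1 m
    have hi1 := h.integrable_fluctuation_sq (m := m) hM hp0 hp1 k
    have hi2 : Integrable (fun ω ↦ X (k + 1) ω * fluctuation p m X k ω) μ :=
      h.integrable_smul hM (by omega) hT
    have hi3 : Integrable (fun ω ↦ q ω * fluctuation p m X k ω) μ :=
      hT.bdd_mul hqm.aestronglyMeasurable hqle
    have hi23 : Integrable (fun ω ↦ 2 * (X (k + 1) ω * fluctuation p m X k ω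
        - q ω * fluctuation p m X k ω)) μ := (hi2.sub hi3).const_mul 2
    have hi123 : Integrable (fun ω ↦ fluctuation p m X k ω ^ 2 +
        2 * (X (k + 1) ω * fluctuation p m X k ω - q ω * fluctuation p m X k ω)) μ := hi1.add hi23
    have hle : ∫ ω, fluctuation p m X (k + 1) ω ^ 2 ∂μ ≤ ∫ ω, (fluctuation p m X k ω ^ 2 +
        2 * (X (k + 1) ω * fluctuation p m X k ω - q ω * fluctuation p m X k ω) + 4) ∂μ := by
      refine integral_mono_ae (h.integrable_fluctuation_sq hM hp0 hp1 (k + 1))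
        (hi123.add (integrable_const _)) ?_
      filter_upwards [hqle, h.ae_abs_le hM (k := k + 1) (by omega)] with ω h1 h2
      have hrec : fluctuation p m X (k + 1) ω = fluctuation p m X k ω + (X (k + 1) ω - q ω) := by
        simp only [fluctuation, q, position_succ]; push_cast; ring
      have hD : |X (k + 1) ω - q ω| ≤ 2 := (abs_sub _ _).trans (by simp only [q]; linarith)
      have hD2 : (X (k + 1) ω - q ω) ^ 2 ≤ 4 := by
        rw [← sq_abs]; nlinarith [abs_nonneg (X (k + 1) ω - q ω)]
      simp only [hrec]
      linarith [add_sq (fluctuation p m X k ω) (X (k + 1) ω - q ω),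
        mul_sub (fluctuation p m X k ω) (X (k + 1) ω) (q ω)]
    rw [integral_add hi123 (integrable_const _), integral_add hi1 hi23, integral_const_mul,
      integral_sub hi2 hi3, horth] at hle
    simp only [sub_self, mul_zero, add_zero, integral_const, probReal_univ, one_smul] at hle
    push_cast
    linarith

/-- The walk at time `n` is nearly a multiple of its position after the `m` remembered steps. -/
lemma norm_integral_cexp_position_sub_firstSteps_le (h : IsElephantWalk μ p (firstSteps m) X)
    (hp0 : 0 < p) (hp1 : p < 1) (hm : 1 ≤ m) {n : ℕ} (hmn : m ≤ n) {s : ℝ} (hs : 0 < s) (u : ℝ) :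
    ‖(∫ ω, Complex.exp ((u * (position X n ω * (m / s) / n) : ℝ) * Complex.I) ∂μ) -
      ∫ ω, Complex.exp ((u * ((2 * p - 1) * position X m ω / s) : ℝ) * Complex.I) ∂μ‖ ≤
      |u| * (2 * (√m / s) * √(m / n) + 2 * (m / n) * √(varBound (2 * p - 1) m / s ^ 2)) := by
  have hM := isMemory_firstSteps hm
  have hm0 : (0 : ℝ) < m := by exact_mod_cast hm
  have hn0 : (0 : ℝ) < n := by exact_mod_cast hm.trans hmn
  have hT := h.integrable_fluctuation (m := m) hM hp0 hp1 n
  have hS := h.integrable_position hM m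
  refine (norm_integral_cexp_sub_le
    ((((h.integrable_position hM n).mul_const _).div_const _).const_mul _)
    (((hS.const_mul _).div_const _).const_mul _)).trans ?_
  have hpt : ∀ ω, |u * (position X n ω * (m / s) / n) - u * ((2 * p - 1) * position X m ω / s)| ≤
      |u| * (m / (n * s) * |fluctuation p m X n ω| + 2 * (m / n) / s * |position X m ω|) := by
    intro ω
    have : u * (position X n ω * (m / s) / n) - u * ((2 * p - 1) * position X m ω / s) =
        u * (m / (n * s) * fluctuation p m X n ω
          + (2 * (1 - p)) * (m / n) / s * position X m ω) := by
      rw [fluctuation]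
      field_simp
      ring
    rw [this, abs_mul]
    refine mul_le_mul_of_nonneg_left ((abs_add_le _ _).trans ?_) (abs_nonneg _)
    rw [abs_mul, abs_mul, abs_of_nonneg (by positivity : (0 : ℝ) ≤ m / (n * s)),
      abs_of_nonneg (div_nonneg (mul_nonneg (by linarith) (by positivity)) hs.le)]
    gcongr
    linarith
  refine (integral_mono (((((h.integrable_position hM n).mul_const _).div_const _).const_mul _).sub
    (((hS.const_mul _).div_const _).const_mul _)).abs
    (((hT.abs.const_mul _).add (hS.abs.const_mul _)).const_mul _) hpt).trans ?_
  rw [integral_const_mul]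
  refine mul_le_mul_of_nonneg_left ?_ (abs_nonneg _)
  change ∫ ω, (m / (n * s) * |fluctuation p m X n ω| + 2 * (m / n) / s * |position X m ω|) ∂μ ≤ _
  rw [integral_add (hT.abs.const_mul _) (hS.abs.const_mul _), integral_const_mul,
    integral_const_mul]
  have h1 : ∫ ω, |fluctuation p m X n ω| ∂μ ≤ 2 * √n := by
    refine (integral_abs_le_sqrt hT (h.integrable_fluctuation_sq hM hp0 hp1 n)).trans ?_
    have h4 : (4 : ℝ) = 2 ^ 2 := by norm_num
    have : √(4 * (n : ℝ)) = 2 * √n := by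
      rw [Real.sqrt_mul (by norm_num), h4, Real.sqrt_sq (by norm_num)]
    rw [← this]
    exact Real.sqrt_le_sqrt ((h.integral_fluctuation_sq_le hp0 hp1 hm hmn).trans (by linarith))
  have h2 : ∫ ω, |position X m ω| ∂μ ≤ √(varBound (2 * p - 1) m) := by
    refine (integral_abs_le_sqrt hS (h.integrable_position_sq hM m)).trans (Real.sqrt_le_sqrt ?_)
    refine h.integral_position_sq_le hM (by linarith) (N := m) (fun k _ hkm ↦ ?_) hm le_rfl
    rw [firstSteps, min_eq_left hkm.le]
  refine (add_le_add (mul_le_mul_of_nonneg_left h1 (by positivity))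
    (mul_le_mul_of_nonneg_left h2 (by positivity))).trans (le_of_eq ?_)
  rw [Real.sqrt_div (varBound_nonneg _ _), Real.sqrt_sq hs.le, Real.sqrt_div hm0.le]
  have hmm : √(m : ℝ) * √m = m := Real.mul_self_sqrt hm0.le
  have e1 : (m : ℝ) / (n * s) * (2 * √n) = 2 * (√m / s) * (√m / √n) := by
    calc (m : ℝ) / (n * s) * (2 * √n) = 2 * (m / s) * (√n / n) := by ring
      _ = 2 * (√m * √m / s) * (1 / √n) := by rw [Real.sqrt_div_self', hmm]
      _ = 2 * (√m / s) * (√m / √n) := by ring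
  rw [e1]
  ring

end IsElephantWalk

end Reduction

/-! ### Convergence in distribution -/

section Distribution

/-- The Lévy continuity theorem for random variables on varying probability spaces. -/
lemma tendstoInDistribution_of_tendsto_integral_cexp {Ω : ℕ → Type*}
    [∀ n, MeasurableSpace (Ω n)] {μ : ∀ n, Measure (Ω n)} [∀ n, IsProbabilityMeasure (μ n)]
    {Ω' : Type*} [MeasurableSpace Ω'] {ν : Measure Ω'} [IsProbabilityMeasure ν]
    {Z : ∀ n, Ω n → ℝ} (hZ : ∀ n, Measurable (Z n)) {W : Ω' → ℝ} (hW : Measurable W)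
    (h : ∀ t : ℝ, Tendsto (fun n ↦ ∫ ω, Complex.exp ((t * Z n ω : ℝ) * Complex.I) ∂(μ n)) atTop
      (𝓝 (∫ ω, Complex.exp ((t * W ω : ℝ) * Complex.I) ∂ν))) :
    TendstoInDistribution Z atTop W μ ν where
  forall_aemeasurable n := (hZ n).aemeasurable
  aemeasurable_limit := hW.aemeasurable
  tendsto := by
    refine ProbabilityMeasure.tendsto_of_tendsto_charFun fun t ↦ ?_
    have hc : Continuous fun x : ℝ ↦ Complex.exp (t * x * Complex.I) := by fun_prop
    have h1 : ∀ n, charFun ((μ n).map (Z n)) t =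
        ∫ ω, Complex.exp ((t * Z n ω : ℝ) * Complex.I) ∂(μ n) := fun n ↦ by
      rw [charFun_apply_real, integral_map (hZ n).aemeasurable hc.aestronglyMeasurable]
      simp
    have h2 : charFun (ν.map W) t = ∫ ω, Complex.exp ((t * W ω : ℝ) * Complex.I) ∂ν := by
      rw [charFun_apply_real, integral_map hW.aemeasurable hc.aestronglyMeasurable]
      simp
    simp only [ProbabilityMeasure.coe_mk, h1, h2]
    exact h t

variable {p : ℝ} {m : ℕ → ℕ} {Ω : ℕ → Type*} [∀ n, MeasurableSpace (Ω n)]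
  {μ : ∀ n, Measure (Ω n)} [∀ n, IsProbabilityMeasure (μ n)] {X : ∀ n, ℕ → Ω n → ℝ}

lemma eventually_le_of_tendsto_div (hm : Tendsto m atTop atTop)
    (hmn : Tendsto (fun n ↦ (m n : ℝ) / (n : ℝ)) atTop (𝓝 0)) :
    ∀ᶠ n in atTop, 1 ≤ m n ∧ m n ≤ n := by
  filter_upwards [hm.eventually_ge_atTop 1, hmn.eventually_lt_const one_pos,
    eventually_ge_atTop 1] with n h1 h2 h3
  refine ⟨h1, ?_⟩
  rw [div_lt_one (by exact_mod_cast h3)] at h2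
  exact_mod_cast h2.le

/-- If the position of the full-memory walk, divided by `s`, converges in distribution along the
times `m n`, then the walk that remembers `m n` steps inherits the limit, up to the factor
`2p - 1`. -/
lemma tendstoInDistribution_position (hp0 : 0 < p) (hp1 : p < 1)
    (hm : Tendsto m atTop atTop) (hmn : Tendsto (fun n ↦ (m n : ℝ) / (n : ℝ)) atTop (𝓝 0))
    (hX : ∀ n, IsElephantWalk (μ n) p (firstSteps (m n)) (X n))
    {s : ℕ → ℝ} (hs : ∀ᶠ k in atTop, 0 < s k)
    {v : ℝ} (hV : Tendsto (fun k ↦ varBound (2 * p - 1) k / s k ^ 2) atTop (𝓝 v))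
    {C : ℝ} (hsC : ∀ᶠ k : ℕ in atTop, √k / s k ≤ C)
    {A : ℕ → ℝ} (hA : ∀ᶠ k : ℕ in atTop, A k = k / s k)
    {Ω' : Type*} [MeasurableSpace Ω'] {ν : Measure Ω'} [IsProbabilityMeasure ν]
    {W : Ω' → ℝ} (hW : Measurable W)
    (hlim : ∀ t : ℝ, Tendsto (fun n ↦ ∫ ω, Complex.exp
        ((t * ((2 * p - 1) * position (X n) (m n) ω / s (m n)) : ℝ) * Complex.I) ∂(μ n)) atTop
      (𝓝 (∫ ω, Complex.exp ((t * W ω : ℝ) * Complex.I) ∂ν))) :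
    TendstoInDistribution (fun n ω ↦ position (X n) n ω * A (m n) / (n : ℝ)) atTop W μ ν := by
  refine tendstoInDistribution_of_tendsto_integral_cexp
    (fun n ↦ (((hX n).measurable_position n).mul_const _).div_const _) hW fun t ↦ ?_
  refine (hlim t).congr_dist ?_
  have hbound : Tendsto (fun n ↦ |t| * (2 * C * √((m n : ℝ) / n) +
      2 * ((m n : ℝ) / n) * √(varBound (2 * p - 1) (m n) / s (m n) ^ 2))) atTop (𝓝 0) := by
    have := (((hmn.sqrt.const_mul (2 * C)).add
      ((hmn.const_mul 2).mul (hV.comp hm).sqrt))).const_mul |t|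
    simpa using this
  refine squeeze_zero' (.of_forall fun _ ↦ dist_nonneg) ?_ hbound
  filter_upwards [eventually_le_of_tendsto_div hm hmn, hm.eventually hs, hm.eventually hsC,
    hm.eventually hA] with n h1 h2 h3 h4
  rw [dist_comm, dist_eq_norm, h4]
  refine ((hX n).norm_integral_cexp_position_sub_firstSteps_le hp0 hp1 h1.1 h1.2 h2 t).trans ?_
  gcongr

/-- The central limit theorem for the full-memory walk at the times `m n`. -/
lemma tendsto_integral_cexp_position_of_tendsto_varBound (hp0 : 0 < p) (hp34 : p ≤ 3 / 4)
    (hm : Tendsto m atTop atTop)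
    (hX : ∀ n, IsElephantWalk (μ n) p (firstSteps (m n)) (X n))
    {s : ℕ → ℝ} (hs : Tendsto s atTop atTop)
    (hs2 : Tendsto (fun k : ℕ ↦ s k / k) atTop (𝓝 0))
    {v : ℝ} (hv : 0 < v) (hV : Tendsto (fun k ↦ varBound (2 * p - 1) k / s k ^ 2) atTop (𝓝 v))
    (t : ℝ) :
    Tendsto (fun n ↦ ∫ ω, Complex.exp
        ((t * ((2 * p - 1) * position (X n) (m n) ω / s (m n)) : ℝ) * Complex.I) ∂(μ n)) atTop
      (𝓝 (Real.exp (-((t * (2 * p - 1)) ^ 2 * v / 2)) : ℂ)) := by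
  set a := 2 * p - 1 with ha_def
  have ha : -1 < a := by linarith
  have hs0 := hs.eventually_gt_atTop 0
  -- `S_k / s_k` at `t a` is the martingale `S_k / b_k` at `c k`
  let c : ℕ → ℝ := fun k ↦ t * a * growth a k / s k
  have hcQ : ∀ k, c k ^ 2 * invSqSum a k = (t * a) ^ 2 * (varBound a k / s k ^ 2) := fun k ↦ by
    simp only [c, varBound]; ring
  have hcQlim : Tendsto (fun k ↦ c k ^ 2 * invSqSum a k) atTop (𝓝 ((t * a) ^ 2 * v)) := by
    simp only [hcQ]; exact hV.const_mul _
  have hVtop : Tendsto (varBound a) atTop atTop := by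
    refine (hV.pos_mul_atTop hv ((tendsto_pow_atTop two_ne_zero).comp hs)).congr' ?_
    filter_upwards [hs0] with k hk
    simp only [Function.comp_apply]
    field_simp
  have hV2 : Tendsto (fun k : ℕ ↦ varBound a k / (k : ℝ) ^ 2) atTop (𝓝 0) := by
    have := hV.mul (hs2.pow 2)
    rw [zero_pow two_ne_zero, mul_zero] at this
    refine this.congr' ?_
    filter_upwards [hs0] with k hk
    field_simp
  have herr := tendsto_cltError_sum ha (tendsto_invSqSum_atTop ha (by linarith)) hVtop hV2
    (hcQlim.eventually_le_const (lt_add_one _))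
  have hexp : Tendsto (fun n ↦ (Real.exp (-(c (m n) ^ 2 * invSqSum a (m n) / 2)) : ℂ)) atTop
      (𝓝 (Real.exp (-((t * a) ^ 2 * v / 2)) : ℂ)) :=
    (Complex.continuous_ofReal.tendsto _).comp
      ((Real.continuous_exp.tendsto _).comp ((hcQlim.div_const 2).neg.comp hm))
  refine hexp.congr_dist (squeeze_zero' (.of_forall fun _ ↦ dist_nonneg) ?_ (herr.comp hm))
  filter_upwards [hm.eventually_ge_atTop 1] with n h1
  have hfull : ∀ k, 1 ≤ k → k < m n → firstSteps (m n) k = Finset.Icc 1 k := fun k _ hk ↦ by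
    rw [firstSteps, min_eq_left hk.le]
  have := (hX n).norm_integral_cexp_position_sub_le (isMemory_firstSteps h1) hp0 (by linarith)
    hfull (c (m n)) h1 le_rfl
  rw [dist_comm, dist_eq_norm]
  refine le_of_eq_of_le ?_ this
  congr 2
  refine integral_congr_ae (ae_of_all _ fun ω ↦ ?_)
  have hg := (growth_pos ha (m n)).ne'
  have : c (m n) / growth a (m n) = t * a / s (m n) := by
    simp only [c]
    rw [mul_div_right_comm, mul_div_assoc, div_self hg, mul_one]
  simp only [← ha_def, this]
  congr 2
  push_cast
  ring

lemma integral_cexp_gaussianReal (t : ℝ) (v : NNReal) :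
    ∫ x, Complex.exp ((t * id x : ℝ) * Complex.I) ∂(gaussianReal 0 v) =
      (Real.exp (-(t ^ 2 * v / 2)) : ℂ) := by
  have := charFun_gaussianReal (μ := 0) (v := v) t
  rw [charFun_apply_real] at this
  simp only [id, Complex.ofReal_mul, this]
  push_cast
  congr 1
  ring

end Distribution

/-! ### The superdiffusive walk -/

section Superdiffusive

lemma integral_cexp_position_one {Ω : Type*} [MeasurableSpace Ω] {μ : Measure Ω}
    [IsProbabilityMeasure μ] {p : ℝ} {M : ℕ → Finset ℕ} {X : ℕ → Ω → ℝ}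
    (h : IsElephantWalk μ p M X) (u : ℝ) :
    ∫ ω, Complex.exp (u * position X 1 ω * Complex.I) ∂μ =
      Real.cos u + (2 * p - 1 : ℝ) * (Real.sin u * Complex.I) := by
  have hsign := ae_eq_one_or_neg_one (h.measurable 1) h.first_pos h.first_neg
  have hae : (fun ω ↦ Complex.exp (u * position X 1 ω * Complex.I)) =ᵐ[μ] fun ω ↦
      (Real.cos u : ℂ) + (X 1 ω : ℂ) * (Real.sin u * Complex.I) := by
    filter_upwards [hsign] with ω hω
    rw [position_one, cexp_mul_sign u hω, mul_assoc]
  have hi : Integrable (X 1) μ := by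
    refine .of_bound (h.measurable 1).aestronglyMeasurable 1 ?_
    filter_upwards [hsign] with ω hω
    rcases hω with hω | hω <;> simp [hω]
  rw [integral_congr_ae hae, integral_add (integrable_const _) (hi.ofReal.mul_const _),
    integral_mul_const, integral_const, integral_complex_ofReal,
    integral_of_two_point (h.measurable 1) h.first_pos h.first_neg]
  simp

lemma charFun_map_position {Ω : Type*} [MeasurableSpace Ω] {μ : Measure Ω} {X : ℕ → Ω → ℝ} {k : ℕ}
    (hX : Measurable (position X k)) (u : ℝ) : charFun (μ.map (position X k)) u =
      ∫ ω, Complex.exp (u * position X k ω * Complex.I) ∂μ := by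
  have hc : Continuous fun x : ℝ ↦ Complex.exp (u * x * Complex.I) := by fun_prop
  rw [charFun_apply_real, integral_map hX.aemeasurable hc.aestronglyMeasurable]

/-- The law of the position is determined by the parameter, as long as the whole past is
remembered. -/
lemma map_position_eq {Ω Ω' : Type*} [MeasurableSpace Ω] [MeasurableSpace Ω'] {μ : Measure Ω}
    [IsProbabilityMeasure μ] {ν : Measure Ω'} [IsProbabilityMeasure ν] {p : ℝ}
    {M M' : ℕ → Finset ℕ} {X : ℕ → Ω → ℝ} {Y : ℕ → Ω' → ℝ}
    (hX : IsElephantWalk μ p M X) (hY : IsElephantWalk ν p M' Y)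
    (hM : IsMemory M) (hM' : IsMemory M') {N : ℕ}
    (hfull : ∀ k, 1 ≤ k → k < N → M k = Finset.Icc 1 k)
    (hfull' : ∀ k, 1 ≤ k → k < N → M' k = Finset.Icc 1 k) {k : ℕ} (hk : 1 ≤ k) (hkN : k ≤ N) :
    μ.map (position X k) = ν.map (position Y k) := by
  induction k, hk using Nat.le_induction with
  | base =>
    have := Measure.isProbabilityMeasure_map (μ := μ) (hX.measurable_position 1).aemeasurable
    have := Measure.isProbabilityMeasure_map (μ := ν) (hY.measurable_position 1).aemeasurable
    refine Measure.ext_of_charFun (funext fun u ↦ ?_)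
    rw [charFun_map_position (hX.measurable_position 1), charFun_map_position (hY.measurable_position 1),
      integral_cexp_position_one hX, integral_cexp_position_one hY]
  | succ k hk ih =>
    have := Measure.isProbabilityMeasure_map (μ := μ) (hX.measurable_position (k + 1)).aemeasurable
    have := Measure.isProbabilityMeasure_map (μ := ν) (hY.measurable_position (k + 1)).aemeasurable
    refine Measure.ext_of_charFun (funext fun u ↦ ?_)
    have hc : Continuous fun x : ℝ ↦ Complex.exp (u * x * Complex.I) *
        (Real.cos u + ((2 * p - 1) * (x / k) : ℝ) * Real.sin u * Complex.I) := by fun_prop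
    rw [charFun_map_position (hX.measurable_position _), charFun_map_position (hY.measurable_position _),
      hX.integral_cexp_position_succ hM hk (hfull k hk hkN),
      hY.integral_cexp_position_succ hM' hk (hfull' k hk hkN),
      ← integral_map (hX.measurable_position k).aemeasurable hc.aestronglyMeasurable,
      ← integral_map (hY.measurable_position k).aemeasurable hc.aestronglyMeasurable,
      ih (by omega)]

variable {Ω : Type*} [MeasurableSpace Ω] {μ : Measure Ω}

namespace IsElephantWalk

variable {p : ℝ} {M : ℕ → Finset ℕ} {X : ℕ → Ω → ℝ}

/-- The filtration generated by the walk; since time starts at `1`, its `n`-th member is generated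
by `X 1, …, X (n + 1)`. -/
def filtration (h : IsElephantWalk μ p M X) : Filtration ℕ ‹MeasurableSpace Ω› where
  seq n := MeasurableSpace.comap (past X (n + 1)) inferInstance
  mono' := by
    intro i j hij
    let r : (Finset.Icc 1 (j + 1) → ℝ) → Finset.Icc 1 (i + 1) → ℝ := fun x l ↦
      x ⟨l, Finset.Icc_subset_Icc le_rfl (by omega) l.2⟩
    have hr : Measurable r := measurable_pi_lambda _ fun l ↦ measurable_pi_apply _
    have : past X (i + 1) = r ∘ past X (j + 1) := rfl
    simp only [this, ← MeasurableSpace.comap_comp]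
    exact MeasurableSpace.comap_mono hr.comap_le
  le' n := (h.measurable_past (n + 1)).comap_le

variable [IsProbabilityMeasure μ]

lemma martingale_position_div_growth (h : IsElephantWalk μ p M X) (hM : IsMemory M)
    (ha : -1 < 2 * p - 1) (hfull : ∀ k, 1 ≤ k → M k = Finset.Icc 1 k) :
    Martingale (fun n ω ↦ position X (n + 1) ω / growth (2 * p - 1) (n + 1)) h.filtration μ := by
  have hi := fun k ↦ h.integrable_position hM k
  refine martingale_of_setIntegral_eq_succ (fun n ↦ ?_) (fun n ↦ (hi _).div_const _) ?_
  · have hm : Measurable fun x : Finset.Icc 1 (n + 1) → ℝ ↦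
        (∑ i : Finset.Icc 1 (n + 1), if (i : ℕ) ≤ n + 1 then x i else 0)
          / growth (2 * p - 1) (n + 1) :=
      (measurable_sum_ite_le (n + 1) (n + 1)).div_const _
    have := hm.comp (comap_measurable (past X (n + 1)))
    refine Measurable.stronglyMeasurable ?_
    convert! this using 1
    ext ω
    rw [position_eq_past X le_rfl]
    rfl
  · suffices hstep : ∀ k, 1 ≤ k → ∀ B : Set (Finset.Icc 1 k → ℝ), MeasurableSet B →
        ∫ ω in past X k ⁻¹' B, position X k ω / growth (2 * p - 1) k ∂μ =
          ∫ ω in past X k ⁻¹' B, position X (k + 1) ω / growth (2 * p - 1) (k + 1) ∂μ by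
      rintro n _ ⟨B, hB, rfl⟩
      exact hstep (n + 1) (by omega) B hB
    intro k hk B hB
    have hBm := h.measurable_past k hB
    have hind : StronglyMeasurable (B.indicator fun _ ↦ (1 : ℝ)) :=
      (measurable_const.indicator hB).stronglyMeasurable
    have hpast : ∀ ω, B.indicator (fun _ ↦ (1 : ℝ)) (past X k ω) =
        (past X k ⁻¹' B).indicator (fun _ ↦ (1 : ℝ)) ω := fun ω ↦ rfl
    have hkey := h.integral_smul_past hM hk hind
      (by simp only [hpast]; exact (integrable_const _).indicator hBm)
    have hmean : ∀ ω, (∑ i ∈ M k, X i ω) / ((M k).card : ℝ) = position X k ω / k := fun ω ↦ by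
      rw [hfull k hk, Nat.card_Icc, Nat.add_sub_cancel, position]
    have hset : ∀ f : Ω → ℝ, ∫ ω, f ω • B.indicator (fun _ ↦ (1 : ℝ)) (past X k ω) ∂μ =
        ∫ ω in past X k ⁻¹' B, f ω ∂μ := fun f ↦ by
      rw [← integral_indicator hBm]
      refine integral_congr_ae (ae_of_all _ fun ω ↦ ?_)
      by_cases hω : past X k ω ∈ B
      · simp [hω]
      · simp [hω]
    simp only [hmean, hset] at hkey
    rw [smul_eq_mul] at hkey
    simp only [position_succ X k, integral_div]
    have hXi : Integrable (X (k + 1)) μ :=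
      .of_bound (h.measurable _).aestronglyMeasurable 1 (h.ae_abs_le hM (by omega))
    rw [integral_add (hi k).integrableOn hXi.integrableOn, hkey, growth_succ, integral_div]
    have h1 := (growth_pos ha k).ne'
    have h2 := (one_add_div_pos ha k).ne'
    rw [div_eq_div_iff h1 (mul_ne_zero h1 h2)]
    ring

/-- A superdiffusive walk with full memory grows like `k ^ (2p - 1)`: the martingale `S_k / b_k` is
bounded in `L²`. -/
lemma exists_ae_tendsto_position_div_rpow (h : IsElephantWalk μ p M X) (hM : IsMemory M)
    (hp : 3 / 4 < p) (hfull : ∀ k, 1 ≤ k → M k = Finset.Icc 1 k) :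
    ∃ L : Ω → ℝ, Measurable L ∧ ∀ᵐ ω ∂μ,
      Tendsto (fun k : ℕ ↦ position X k ω / (k : ℝ) ^ (2 * p - 1)) atTop (𝓝 (L ω)) := by
  set a := 2 * p - 1 with ha_def
  have ha : -1 < a := by linarith
  have hmart := h.martingale_position_div_growth hM ha hfull
  set Z : ℕ → Ω → ℝ := fun n ω ↦ position X (n + 1) ω / growth a (n + 1) with hZ
  have hsum := (summable_inv_growth_sq_iff ha).2 (by linarith : 1 / 2 < a)
  set R := ∑' k : ℕ, (growth a (k + 1) ^ 2)⁻¹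
  have hbdd : ∀ n, eLpNorm (Z n) 1 μ ≤ (√R).toNNReal := by
    intro n
    have hZi : Integrable (Z n) μ := (h.integrable_position hM _).div_const _
    have hsq : (fun ω ↦ Z n ω ^ 2) =
        fun ω ↦ (growth a (n + 1) ^ 2)⁻¹ * position X (n + 1) ω ^ 2 := by
      ext ω; simp only [hZ]; rw [div_pow, div_eq_inv_mul]
    have hZ2 : Integrable (fun ω ↦ Z n ω ^ 2) μ := by
      rw [hsq]; exact (h.integrable_position_sq hM _).const_mul _
    have hle : ∫ ω, Z n ω ^ 2 ∂μ ≤ R := by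
      rw [hsq, integral_const_mul]
      have h1 := h.integral_position_sq_le hM ha (N := n + 1) (fun k hk _ ↦ hfull k hk)
        (by omega : 1 ≤ n + 1) le_rfl
      have hg : growth a (n + 1) ^ 2 ≠ 0 := pow_ne_zero 2 (growth_pos ha _).ne'
      refine (mul_le_mul_of_nonneg_left h1 (by positivity)).trans ?_
      rw [varBound, inv_mul_cancel_left₀ hg]
      exact hsum.sum_le_tsum _ fun _ _ ↦ by positivity
    rw [eLpNorm_one_eq_lintegral_enorm, ← ofReal_integral_norm_eq_lintegral_enorm hZi]
    exact ENNReal.ofReal_le_ofReal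
      ((integral_abs_le_sqrt hZi hZ2).trans (Real.sqrt_le_sqrt hle))
  have hconv : ∀ᵐ ω ∂μ, ∃ l, Tendsto (fun k : ℕ ↦ position X k ω / (k : ℝ) ^ a) atTop (𝓝 l) := by
    filter_upwards [hmart.submartingale.exists_ae_tendsto_of_bdd hbdd] with ω ⟨l, hl⟩
    rw [tendsto_add_atTop_iff_nat (f := fun n ↦ position X n ω / growth a n) 1] at hl
    refine ⟨_, (hl.mul (tendsto_growth_div_rpow ha)).congr fun k ↦ ?_⟩
    exact div_mul_div_cancel₀ (growth_pos ha k).ne'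
  exact measurable_limit_of_tendsto_metrizable_ae
    (fun k ↦ ((h.measurable_position k).div_const _).aemeasurable) hconv

end IsElephantWalk

end Superdiffusive

/-! ### The limit theorems -/

theorem mainTheorem1 (p : ℝ) (hp0 : 0 < p) (hp1 : p < 1)
    (m : ℕ → ℕ) (hm : Tendsto m atTop atTop)
    (hmn : Tendsto (fun n => (m n : ℝ) / (n : ℝ)) atTop (𝓝 0))
    {Ω : ℕ → Type*} [∀ n, MeasurableSpace (Ω n)]
    (μ : ∀ n, Measure (Ω n)) [∀ n, IsProbabilityMeasure (μ n)]
    (X : ∀ n, ℕ → Ω n → ℝ)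
    (hX : ∀ n, IsElephantWalk (μ n) p (firstSteps (m n)) (X n)) :
    (p < 3 / 4 →
      TendstoInDistribution
        (fun n ω => position (X n) n ω * √(m n : ℝ) / (n : ℝ)) atTop (id : ℝ → ℝ) μ
        (gaussianReal 0 ((2 * p - 1) ^ 2 / (3 - 4 * p)).toNNReal)) ∧
    (p = 3 / 4 →
      TendstoInDistribution
        (fun n ω => position (X n) n ω * √((m n : ℝ) / Real.log (m n)) / (n : ℝ)) atTop
        (id : ℝ → ℝ) μ (gaussianReal 0 (1 / 4))) ∧
    (3 / 4 < p →
      ∀ {Ω' : Type*} [MeasurableSpace Ω'] (ν : Measure Ω') [IsProbabilityMeasure ν]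
        (Y : ℕ → Ω' → ℝ), IsElephantWalk ν p fullMemory Y →
        ∃ L : Ω' → ℝ, Measurable L ∧
          (∀ᵐ ω ∂ν, Tendsto (fun k : ℕ => position Y k ω / (k : ℝ) ^ (2 * p - 1)) atTop
            (𝓝 (L ω))) ∧
          TendstoInDistribution
            (fun n ω => position (X n) n ω * (m n : ℝ) ^ (2 * (1 - p)) / (n : ℝ)) atTop
            (fun ω => (2 * p - 1) * L ω) μ ν) := by
  refine ⟨fun hp ↦ ?_, fun hp ↦ ?_, fun hp Ω' _ ν _ Y hY ↦ ?_⟩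
  · have hV : Tendsto (fun k : ℕ ↦ varBound (2 * p - 1) k / √(k : ℝ) ^ 2) atTop
        (𝓝 (1 - 2 * (2 * p - 1))⁻¹) := by
      refine (tendsto_varBound_div_of_lt (by linarith) (by linarith)).congr fun k ↦ ?_
      rw [Real.sq_sqrt (Nat.cast_nonneg k)]
    have hs : Tendsto (fun k : ℕ ↦ √(k : ℝ)) atTop atTop :=
      Real.tendsto_sqrt_atTop.comp tendsto_natCast_atTop_atTop
    have hs2 : Tendsto (fun k : ℕ ↦ √(k : ℝ) / k) atTop (𝓝 0) := by
      simp only [Real.sqrt_div_self']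
      exact tendsto_const_nhds.div_atTop hs
    refine tendstoInDistribution_position (s := fun k ↦ √(k : ℝ)) (A := fun k ↦ √(k : ℝ)) (C := 1)
      hp0 hp1 hm hmn hX (hs.eventually_gt_atTop 0) hV (.of_forall fun k ↦ div_self_le_one _)
      (.of_forall fun k ↦ Real.div_sqrt.symm) measurable_id fun t ↦ ?_
    have h3 : (0 : ℝ) < 3 - 4 * p := by linarith
    rw [integral_cexp_gaussianReal, Real.coe_toNNReal _ (by positivity)]
    convert! tendsto_integral_cexp_position_of_tendsto_varBound hp0 hp.le hm hX hs hs2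
      (inv_pos.2 (by linarith)) hV t using 5
    rw [show 1 - 2 * (2 * p - 1) = 3 - 4 * p by ring]
    ring
  · have h2p : 2 * p - 1 = 1 / 2 := by linarith
    have hlog : Tendsto (fun k : ℕ ↦ Real.log k) atTop atTop :=
      Real.tendsto_log_atTop.comp tendsto_natCast_atTop_atTop
    have hpos : ∀ᶠ k : ℕ in atTop, 0 < (k : ℝ) ∧ 1 ≤ Real.log k :=
      (tendsto_natCast_atTop_atTop.eventually_gt_atTop 0).and (hlog.eventually_ge_atTop 1)
    have hV : Tendsto (fun k : ℕ ↦ varBound (2 * p - 1) k / √(k * Real.log k : ℝ) ^ 2) atTop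
        (𝓝 1) := by
      rw [h2p]
      refine tendsto_varBound_div_log.congr' ?_
      filter_upwards [hpos] with k hk
      rw [Real.sq_sqrt (mul_nonneg hk.1.le (by linarith))]
    have hs : Tendsto (fun k : ℕ ↦ √(k * Real.log k : ℝ)) atTop atTop :=
      Real.tendsto_sqrt_atTop.comp (tendsto_natCast_atTop_atTop.atTop_mul_atTop₀ hlog)
    have hs2 : Tendsto (fun k : ℕ ↦ √(k * Real.log k : ℝ) / k) atTop (𝓝 0) := by
      have : Tendsto (fun k : ℕ ↦ √(Real.log k / k)) atTop (𝓝 0) := by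
        have h := (Real.isLittleO_log_id_atTop.tendsto_div_nhds_zero.comp
          tendsto_natCast_atTop_atTop (α := ℕ)).sqrt
        simpa using h
      refine this.congr' ?_
      filter_upwards [hpos] with k hk
      have h0 := hk.1
      rw [← Real.sqrt_sq h0.le, ← Real.sqrt_div' _ (by positivity), Real.sqrt_sq h0.le]
      congr 1
      field_simp
    refine tendstoInDistribution_position (s := fun k ↦ √(k * Real.log k : ℝ))
      (A := fun k ↦ √(k / Real.log k : ℝ)) (C := 1)
      hp0 hp1 hm hmn hX (hs.eventually_gt_atTop 0) hV ?_ ?_ measurable_id fun t ↦ ?_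
    · filter_upwards [hpos] with k hk
      refine div_le_one_of_le₀ (Real.sqrt_le_sqrt ?_) (Real.sqrt_nonneg _)
      exact le_mul_of_one_le_right hk.1.le hk.2
    · filter_upwards [hpos] with k hk
      have h0 := hk.1
      have h1 : 0 < Real.log k := by linarith
      rw [eq_div_iff (Real.sqrt_pos.2 (by positivity)).ne', ← Real.sqrt_mul (by positivity),
        show (k : ℝ) / Real.log k * (k * Real.log k) = k ^ 2 by field_simp, Real.sqrt_sq h0.le]
    · rw [integral_cexp_gaussianReal]
      convert! tendsto_integral_cexp_position_of_tendsto_varBound hp0 hp.le hm hX hs hs2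
        one_pos hV t using 5
      rw [h2p]
      push_cast
      ring
  · have hmem := isMemory_fullMemory
    obtain ⟨L, hL, hlim⟩ := hY.exists_ae_tendsto_position_div_rpow hmem hp fun _ _ ↦ rfl
    refine ⟨L, hL, hlim, ?_⟩
    have hpos : ∀ᶠ k : ℕ in atTop, 1 ≤ (k : ℝ) :=
      tendsto_natCast_atTop_atTop.eventually_ge_atTop 1
    obtain ⟨v, hV⟩ := exists_tendsto_varBound_div_rpow (by linarith : 1 / 2 < 2 * p - 1)
    refine tendstoInDistribution_position (s := fun k ↦ (k : ℝ) ^ (2 * p - 1))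
      (A := fun k ↦ (k : ℝ) ^ (2 * (1 - p))) (C := 1)
      hp0 hp1 hm hmn hX ?_ hV ?_ ?_ (hL.const_mul _) fun t ↦ ?_
    · filter_upwards [hpos] with k hk
      exact Real.rpow_pos_of_pos (by linarith) _
    · filter_upwards [hpos] with k hk
      refine div_le_one_of_le₀ ?_ (Real.rpow_nonneg (by linarith) _)
      rw [Real.sqrt_eq_rpow]
      exact Real.rpow_le_rpow_of_exponent_le hk (by linarith)
    · filter_upwards [hpos] with k hk
      have h0 : (0 : ℝ) < k := by linarith
      rw [eq_div_iff (Real.rpow_pos_of_pos h0 _).ne', ← Real.rpow_add h0]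
      ring_nf
      exact Real.rpow_one _
    · have hc : ∀ k : ℕ, Continuous fun x : ℝ ↦
          Complex.exp ((t * ((2 * p - 1) * x / (k : ℝ) ^ (2 * p - 1)) : ℝ) * Complex.I) :=
        fun k ↦ by fun_prop
      have hYlim : Tendsto (fun k : ℕ ↦ ∫ ω, Complex.exp
          ((t * ((2 * p - 1) * position Y k ω / (k : ℝ) ^ (2 * p - 1)) : ℝ) * Complex.I) ∂ν) atTop
          (𝓝 (∫ ω, Complex.exp ((t * ((2 * p - 1) * L ω) : ℝ) * Complex.I) ∂ν)) := by
        refine tendsto_integral_of_dominated_convergence (fun _ ↦ 1) (fun k ↦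
          ((hc k).measurable.comp (hY.measurable_position k)).aestronglyMeasurable)
          (integrable_const _) (fun k ↦ ae_of_all _ fun ω ↦
            (Complex.norm_exp_ofReal_mul_I _).le) ?_
        filter_upwards [hlim] with ω hω
        have hce : Continuous fun x : ℝ ↦
          Complex.exp ((t * ((2 * p - 1) * x) : ℝ) * Complex.I) := by fun_prop
        refine ((hce.tendsto _).comp hω).congr fun k ↦ ?_
        simp only [Function.comp_apply, mul_div_assoc]
      refine (hYlim.comp hm).congr' ?_
      filter_upwards [hm.eventually_ge_atTop 1] with n h1
      have hmap := map_position_eq (hX n) hY (isMemory_firstSteps h1) hmem (N := m n)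
        (fun k _ hk ↦ by rw [firstSteps, min_eq_left hk.le]) (fun _ _ _ ↦ rfl) h1 le_rfl
      have e1 := integral_map (μ := μ n) ((hX n).measurable_position (m n)).aemeasurable
        (hc (m n)).aestronglyMeasurable
      have e2 := integral_map (μ := ν) (hY.measurable_position (m n)).aemeasurable
        (hc (m n)).aestronglyMeasurable
      rw [hmap] at e1
      exact e2.symm.trans e1
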